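/- **Notation.** Let $\mathcal R$ be a term rewrite system (TRS) over a signature $\Sigma$ and an infinite set $\mathcal V$ of variables (left-hand sides are not variables, $\mathcal V(r)\subseteq\mathcal V(\ell)$ for every rule $\ell\to r$). A symbol is *defined* for a TRS if it is the root of a left-hand side, and a *constructor* otherwise; a term $f(t_1,\dots,t_k)$ is *basic* if $f$ is defined and the $t_i$ contain no defined symbols. $\mathrm{Dh}(t,\to)\in\mathbb N\cup\{\omega\}$ is the supremum of the lengths of $\to$-sequences from $t$, and $|t|$ is the size of $t$ (the number of occurrences of symbols and variables). A step is *innermost* if the proper subterms of its redex are normal forms; $\to_{\mathcal R,\mathrm i}$ is innermost rewriting with $\mathcal R$. Extend $\Sigma$ by a fresh symbol $f^\sharp$ of the same arity for every defined symbol $f$ of $\mathcal R$ and by compound symbols $\mathsf{Com}_n$ of arity $n$. Put $f(t_1,\dots,t_k)^\sharp=f^\sharp(t_1,\dots,t_k)$ if $f$ is a defined symbol of $\mathcal R$, and $t^\sharp=t$ for all other terms. Sharp terms are the $t^\sharp$ with $t$ a $\Sigma$-term with defined root. A dependency tuple (DT) is a rule $s^\sharp\to\mathsf{Com}_n(t_1^\sharp,\dots,t_n^\sharp)$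 between sharp terms, with no extra variables on the right. A *DT problem* $\langle\mathcal D,\mathcal S,\mathcal R\rangle$ consists of a TRS $\mathcal R$, a set $\mathcal D$ of DTs and $\mathcal S\subseteq\mathcal D$. A $(\mathcal D,\mathcal R)$-*chain tree* for a term $s$ is a possibly infinite tree whose nodes are labelled with pairs $(u^\sharp\to\mathsf{Com}_m(v_1^\sharp,\dots,v_m^\sharp)\mid\mu)$ of a DT from $\mathcal D$ and a substitution such that: the left-hand side of the root's DT, instantiated with the root's substitution, is $s$; for every node, $u^\sharp\mu$ is a normal form with respect to $\mathcal R$; and if the children of the node are labelled $(p_j^\sharp\to\cdots\mid\delta_j)$, $1\le j\le k$, there are pairwise different $i_1,\dots,i_k\in\{1,\dots,m\}$ with $v_{i_j}^\sharp\mu\to_{\mathcal R,\mathrm i}^*p_j^\sharp\delta_j$. $\mathrm{Cplx}_{\langle\mathcal D,\mathcal S,\mathcal R\rangle}(s)\in\mathbb N\cup\{\omega\}$ is the supremum, over all chain trees for $s$, of the number of nodes labelled with a DT from $\mathcal S$ ($0$ if there is no chain tree), and $\mathrm{irc}_{\langle\mathcal D,\mathcal S,\mathcal R\rangle}(n)=\sup\{\mathrm{Cplx}_{\langle\mathcal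 D,\mathcal S,\mathcal R\rangle}(t^\sharp)\mid t\text{ a basic term for }\mathcal R,\ |t|\le n\}$. For TRSs $\mathcal A,\mathcal B$, the relation $\to_{\mathcal A/\mathcal B,\mathrm i}$ consists of one $\mathcal A$-step preceded and followed by arbitrarily many $\mathcal B$-steps, where the proper subterms of all redexes are normal forms with respect to $\mathcal A\cup\mathcal B$; and $\mathrm{irc}_{\mathcal A/\mathcal B}(n)=\sup\{\mathrm{Dh}(t,\to_{\mathcal A/\mathcal B,\mathrm i})\mid t\text{ a basic term for }\mathcal A\cup\mathcal B,\ |t|\le n\}$. Terms here are over the extended signature. Let $\mathit{rel}(\langle\mathcal D,\mathcal S,\mathcal R\rangle)=\mathcal S/((\mathcal D\setminus\mathcal S)\cup\mathcal R)$. A term $s$ rewrites *innermost in parallel* to $t$ if $s\to_{\mathcal R,\mathrm i}^+t$ and either $s$ is an innermost redex and $s\to_{\mathcal R,\mathrm i}t$, or $s=f(s_1,\dots,s_k)$, $t=f(t_1,\dots,t_k)$ and for every $i$ either $s_i$ rewrites innermost in parallel to $t_i$ or $s_i=t_i$ is a normal form. $\mathrm{pirc}_{\mathcal R}(n)$ is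 the supremum of the derivation heights, with respect to this relation, of the basic terms $t$ for $\mathcal R$ with $|t|\le n$. A *maximal structural dependency chain* of a term $r$ is a list $\pi_1>\dots>\pi_k$ ($\pi>\tau$ meaning that $\pi$ is strictly below $\tau$) of positions of defined symbols in $r$ that is empty only if $r$ has no defined symbols, and otherwise is such that there is no defined symbol strictly below $\pi_1$ and every position of a defined symbol strictly above $\pi_1$ is in the list. $\mathrm{PDT}(\mathcal R)$ is the set of all DTs $\ell^\sharp\to\mathsf{Com}_k((r|_{\pi_1})^\sharp,\dots,(r|_{\pi_k})^\sharp)$ with $\ell\to r\in\mathcal R$ and $\pi_1,\dots,\pi_k$ a maximal structural dependency chain of $r$. **Theorem 4.4.** Let $\langle\mathcal D,\mathcal S,\mathcal R\rangle$ be a DT problem. (a) There is a type assignment with two sorts $\mathsf{bot},\mathsf{dt}$, of the form $f:\mathsf{bot}^k\to\mathsf{bot}$ for $f\in\Sigma$, $f^\sharp:\mathsf{bot}^k\to\mathsf{dt}$, $\mathsf{Com}_k:\mathsf{dt}^k\to\mathsf{dt}$, such that for every rule $\ell\to r\in\mathcal D\cup\mathcal R$ the terms $\ell$ and $r$ are well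 typed with the same sort, and for every well-typed basic term $t$ for $\mathcal D\cup\mathcal R$, $$\mathrm{Cplx}_{\langle\mathcal D,\mathcal S,\mathcal R\rangle}(t^\sharp)\ \ge\ \mathrm{Dh}\bigl(t,\to_{\mathcal S/((\mathcal D\setminus\mathcal S)\cup\mathcal R),\mathrm i}\bigr).$$ (b) $\mathrm{irc}_{\langle\mathcal D,\mathcal S,\mathcal R\rangle}(n)\ge\mathrm{irc}_{\mathcal S/((\mathcal D\setminus\mathcal S)\cup\mathcal R)}(n)$ for all $n\in\mathbb N$. Moreover, if parallel-innermost rewriting with $\mathcal R$ on $\Sigma$-terms is confluent, then lower bounds transfer to $\mathrm{pirc}_{\mathcal R}$: $\mathrm{pirc}_{\mathcal R}(n)\ge\mathrm{irc}_{\mathit{rel}(\langle\mathrm{PDT}(\mathcal R),\mathrm{PDT}(\mathcal R),\mathcal R\rangle)}(n)$ for all $n\in\mathbb N$. -/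

import Mathlib

universe u u' v w

namespace DepTuple

/-! ### Terms

A signature is the family of function symbols of a first-order language (its relation symbols play
no role), and `L.Term V` is the set of terms over the signature `L` and the variables `V`.
The application of a substitution `σ : V → L.Term V` to `t` is `t.subst σ`.  Only the finitely many
values of `σ` on the variables of a rule matter for a rewrite step or for the label of a node of a
chain tree, so finiteness of the domain of `σ` is not required. -/

section Terms

variable {L : FirstOrder.Language.{u, u'}} {V : Type v}

/-- The size of a term. -/
def tsize : L.Term V → ℕ
  | .var _ => 1
  | .func _ ts => 1 + ∑ i, tsize (ts i)

/-- The set of variables of a term. -/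
def tvars : L.Term V → Set V
  | .var x => {x}
  | .func _ ts => ⋃ i, tvars (ts i)

/-- `subtermAt π t` is the subterm of `t` at position `π`, and `none` if `π` is not a position
of `t`.  The arguments of a function symbol are numbered from `0`. -/
def subtermAt : List ℕ → L.Term V → Option (L.Term V)
  | [], t => some t
  | _ :: _, .var _ => none
  | i :: π, .func (l := n) _ ts => if h : i < n then subtermAt π (ts ⟨i, h⟩) else none

/-- The strict prefix order on positions: `PosGT τ π` means `τ > π`, i.e. `τ` is strictly
below `π`. -/
def PosGT (τ π : List ℕ) : Prop := ∃ π' : List ℕ, π' ≠ [] ∧ π ++ π' = τ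

/-- `u` is a proper subterm of `t`. -/
def ProperSubterm (u t : L.Term V) : Prop :=
  ∃ π : List ℕ, π ≠ [] ∧ subtermAt π t = some u

end Terms

/-! ### Term rewrite systems -/

/-- A pair of terms `lhs → rhs`. -/
@[ext]
structure Rule (L : FirstOrder.Language.{u, u'}) (V : Type v) where
  lhs : L.Term V
  rhs : L.Term V

section Rewriting

variable {L : FirstOrder.Language.{u, u'}} {V : Type v}

/-- The right-hand side has no variables that do not occur in the left-hand side. -/
def VarCond (ρ : Rule L V) : Prop := tvars ρ.rhs ⊆ tvars ρ.lhs

/-- `R` is a term rewrite system: no left-hand side is a variable, and the variable condition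
holds.  (Finiteness of `R` is not needed.) -/
def IsTRS (R : Set (Rule L V)) : Prop :=
  ∀ ρ ∈ R, (∀ x : V, ρ.lhs ≠ .var x) ∧ VarCond ρ

/-- The rewrite relation of `R`: one step inside an arbitrary context. -/
inductive Step (R : Set (Rule L V)) : L.Term V → L.Term V → Prop
  | root (ρ : Rule L V) (hρ : ρ ∈ R) (σ : V → L.Term V) :
      Step R (ρ.lhs.subst σ) (ρ.rhs.subst σ)
  | arg {n : ℕ} (f : L.Functions n) (ts : Fin n → L.Term V) (i : Fin n) (t' : L.Term V) :
      Step R (ts i) t' → Step R (.func f ts) (.func f (Function.update ts i t'))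

/-- `t` is a normal form with respect to `R`. -/
def NF (R : Set (Rule L V)) (t : L.Term V) : Prop := ¬ ∃ t', Step R t t'

/-- A rewrite step with a rule from `A` for which the proper subterms of the redex are in normal
form with respect to `N`. -/
inductive IStep (N A : Set (Rule L V)) : L.Term V → L.Term V → Prop
  | root (ρ : Rule L V) (hρ : ρ ∈ A) (σ : V → L.Term V)
      (hN : ∀ u, ProperSubterm u (ρ.lhs.subst σ) → NF N u) :
      IStep N A (ρ.lhs.subst σ) (ρ.rhs.subst σ)
  | arg {n : ℕ} (f : L.Functions n) (ts : Fin n → L.Term V) (i : Fin n) (t' : L.Term V) :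
      IStep N A (ts i) t' → IStep N A (.func f ts) (.func f (Function.update ts i t'))

/-- The innermost rewrite relation of `R`. -/
def Ito (R : Set (Rule L V)) : L.Term V → L.Term V → Prop := IStep R R

/-- `s` is an innermost redex of `R`. -/
def InnermostRedex (R : Set (Rule L V)) (s : L.Term V) : Prop :=
  (∃ ρ ∈ R, ∃ σ : V → L.Term V, s = ρ.lhs.subst σ) ∧ ∀ u, ProperSubterm u s → NF R u

/-- Parallel-innermost rewriting: all innermost redexes are contracted simultaneously. -/
def Pito (R : Set (Rule L V)) : L.Term V → L.Term V → Prop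
  | .var x, t =>
      Relation.TransGen (Ito R) (.var x) t ∧ Ito R (.var x) t ∧ InnermostRedex R (.var x)
  | .func f ss, t =>
      Relation.TransGen (Ito R) (.func f ss) t ∧
        ((Ito R (.func f ss) t ∧ InnermostRedex R (.func f ss)) ∨
          ∃ ts, t = .func f ts ∧
            ∀ k, Pito R (ss k) (ts k) ∨ (ss k = ts k ∧ NF R (ts k)))

/-- Confluence of a relation. -/
def Confluent {α : Type*} (r : α → α → Prop) : Prop :=
  ∀ s t u, Relation.ReflTransGen r s t → Relation.ReflTransGen r s u →
    ∃ v, Relation.ReflTransGen r t v ∧ Relation.ReflTransGen r u v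

/-- The `e`-th iterate of a relation. -/
def iter {α : Type*} (r : α → α → Prop) : ℕ → α → α → Prop
  | 0 => Eq
  | e + 1 => Relation.Comp r (iter r e)

/-- The derivation height of `t`: the supremum in `ℕ ∪ {ω}` of the lengths of `r`-sequences
from `t`. -/
noncomputable def Dh {α : Type*} (r : α → α → Prop) (t : α) : ℕ∞ :=
  ⨆ (e : ℕ) (_ : ∃ t', iter r e t t'), (e : ℕ∞)

/-- The defined symbols of `R`, of arity `n`. -/
def DefSyms (R : Set (Rule L V)) (n : ℕ) : Set (L.Functions n) :=
  {f | ∃ ρ ∈ R, ∃ ts, ρ.lhs = .func f ts}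

/-- `t` contains no defined symbols of `R`. -/
def ConstructorTerm (R : Set (Rule L V)) : L.Term V → Prop
  | .var _ => True
  | .func (l := n) f ts => f ∉ DefSyms R n ∧ ∀ i, ConstructorTerm R (ts i)

/-- The basic terms for `R`. -/
def Basic (R : Set (Rule L V)) : Set (L.Term V) :=
  {t | ∃ (n : ℕ) (f : L.Functions n) (ts : Fin n → L.Term V),
    t = .func f ts ∧ f ∈ DefSyms R n ∧ ∀ i, ConstructorTerm R (ts i)}

/-- Parallel-innermost runtime complexity. -/
noncomputable def pirc (R : Set (Rule L V)) (n : ℕ) : ℕ∞ :=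
  ⨆ (t : L.Term V) (_ : t ∈ Basic R ∧ tsize t ≤ n), Dh (Pito R) t

/-- The relative rewrite system `strict / weak`. -/
structure RelTRS (L : FirstOrder.Language.{u, u'}) (V : Type v) where
  strict : Set (Rule L V)
  weak : Set (Rule L V)

/-- The innermost rewrite relation of a relative rewrite system: exactly one step with a strict
rule, and arbitrarily many steps with weak rules before and after it, where all proper subterms of
all redexes are in normal form with respect to all rules. -/
def RelIto (P : RelTRS L V) (s t : L.Term V) : Prop :=
  ∃ s' s'', Relation.ReflTransGen (IStep (P.strict ∪ P.weak) P.weak) s s' ∧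
    IStep (P.strict ∪ P.weak) P.strict s' s'' ∧
    Relation.ReflTransGen (IStep (P.strict ∪ P.weak) P.weak) s'' t

/-- The innermost runtime complexity of a relative rewrite system. -/
noncomputable def ircRel (P : RelTRS L V) (n : ℕ) : ℕ∞ :=
  ⨆ (t : L.Term V) (_ : t ∈ Basic (P.strict ∪ P.weak) ∧ tsize t ≤ n), Dh (RelIto P) t

end Rewriting

/-! ### Dependency tuples -/

/-- The `n`-ary symbols of the signature extended by sharp symbols and compound symbols: the
original symbols, a fresh `f♯` for every defined symbol `f`, and the compound symbol `Com_n`. -/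
inductive DTFunctions {L : FirstOrder.Language.{u, u'}} {V : Type v} (R : Set (Rule L V)) (n : ℕ) : Type u
  | base (f : L.Functions n)
  | sharp (f : L.Functions n) (hf : f ∈ DefSyms R n)
  | com

/-- The extended signature. -/
def dtLang {L : FirstOrder.Language.{u, u'}} {V : Type v} (R : Set (Rule L V)) : FirstOrder.Language.{u, u'} where
  Functions := DTFunctions R
  Relations := L.Relations

section DT

variable {L : FirstOrder.Language.{u, u'}} {V : Type v} (R : Set (Rule L V))

/-- The inclusion of the original signature into the extended one. -/
def incl : L →ᴸ dtLang R where
  onFunction := fun _ f => DTFunctions.base f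
  onRelation := fun _ r => r

/-- Terms over the original signature, as terms over the extended one. -/
def emb (t : L.Term V) : (dtLang R).Term V := (incl R).onTerm t

/-- The rewrite system `R`, as a rewrite system over the extended signature. -/
def embR : Set (Rule (dtLang R) V) := {ρ' | ∃ ρ ∈ R, ρ' = ⟨emb R ρ.lhs, emb R ρ.rhs⟩}

/-- The term `Com_n(ts)`. -/
def com {n : ℕ} (ts : Fin n → (dtLang R).Term V) : (dtLang R).Term V :=
  FirstOrder.Language.Term.func (L := dtLang R) DTFunctions.com ts

open Classical in
/-- The term `t♯`: a defined symbol `f` of `R` at the root of `t` is replaced by `f♯`; all other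
terms are unchanged. -/
noncomputable def sharp : (dtLang R).Term V → (dtLang R).Term V
  | .func (l := n) (DTFunctions.base f) ts =>
      if hf : f ∈ DefSyms R n then
        FirstOrder.Language.Term.func (L := dtLang R) (DTFunctions.sharp f hf) ts
      else FirstOrder.Language.Term.func (L := dtLang R) (DTFunctions.base f) ts
  | t => t

/-- The sharp terms: all `t♯` with `t` a term over the original signature whose root is a defined
symbol of `R`. -/
def SharpTerms : Set ((dtLang R).Term V) :=
  {s | ∃ (n : ℕ) (f : L.Functions n) (ts : Fin n → L.Term V),
    f ∈ DefSyms R n ∧ s = sharp R (emb R (.func f ts))}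

/-- `ρ` is a dependency tuple `s♯ → Com_n(t₁♯, …, tₙ♯)`. -/
def IsDT (ρ : Rule (dtLang R) V) : Prop :=
  ρ.lhs ∈ SharpTerms R ∧
    (∃ (n : ℕ) (ts : Fin n → (dtLang R).Term V),
      (∀ i, ts i ∈ SharpTerms R) ∧ ρ.rhs = com R ts) ∧
    VarCond ρ

/-- `⟨D, S, R⟩` is a DT problem. -/
structure IsDTProblem (D S : Set (Rule (dtLang R) V)) : Prop where
  trs : IsTRS R
  dt : ∀ ρ ∈ D, IsDT R ρ
  sub : S ⊆ D

/-! ### Chain trees and complexity of DT problems -/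

/-- A possibly infinite tree whose nodes are labelled with rules and substitutions.  Nodes are
addresses; `label p = none` means that there is no node at `p`.  Not all numbers need to be used
for the children of a node: the `i`-th child of a node will be the one that belongs to the `i`-th
argument of the compound symbol of the node. -/
structure LTree (L' : FirstOrder.Language.{u, u'}) (V : Type v) where
  label : List ℕ → Option (Rule L' V × (V → L'.Term V))
  prefix_closed : ∀ p i, label p = none → label (p ++ [i]) = none

/-- The number, in `ℕ ∪ {ω}`, of nodes of `T` labelled with a rule from `S`. -/
noncomputable def LTree.count {L' : FirstOrder.Language.{u, u'}} {V : Type v} (T : LTree L' V)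
    (S : Set (Rule L' V)) : ℕ∞ :=
  {p : List ℕ | ∃ ρ μ, T.label p = some (ρ, μ) ∧ ρ ∈ S}.encard

/-- `T` is a `(D, R)`-chain tree for the term `s`.  Different children of a node belong to different
arguments of the compound symbol of the node, as they have different indices `i`. -/
structure IsChainTree (D : Set (Rule (dtLang R) V)) (s : (dtLang R).Term V)
    (T : LTree (dtLang R) V) : Prop where
  root : ∃ ρ σ, T.label [] = some (ρ, σ) ∧ ρ.lhs.subst σ = s
  node : ∀ p ρ μ, T.label p = some (ρ, μ) → ρ ∈ D ∧ NF (embR R) (ρ.lhs.subst μ)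
  edge : ∀ p i ρ μ ρ' δ, T.label p = some (ρ, μ) → T.label (p ++ [i]) = some (ρ', δ) →
    ∃ (m : ℕ) (vs : Fin m → (dtLang R).Term V) (h : i < m), ρ.rhs = com R vs ∧
      Relation.ReflTransGen (Ito (embR R)) ((vs ⟨i, h⟩).subst μ) (ρ'.lhs.subst δ)

/-- The complexity `Cplx_⟨D, S, R⟩(s)`; it is `0` if `s` has no chain tree. -/
noncomputable def Cplx (D S : Set (Rule (dtLang R) V)) (s : (dtLang R).Term V) : ℕ∞ :=
  ⨆ (T : LTree (dtLang R) V) (_ : IsChainTree R D s T), T.count S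

/-- The complexity function of the DT problem `⟨D, S, R⟩`. -/
noncomputable def ircDT (D S : Set (Rule (dtLang R) V)) (n : ℕ) : ℕ∞ :=
  ⨆ (t : L.Term V) (_ : t ∈ Basic R ∧ tsize t ≤ n), Cplx R D S (sharp R (emb R t))

/-- The relative rewrite system `S / ((D ∖ S) ∪ R)` of the DT problem `⟨D, S, R⟩`. -/
def relOf (D S : Set (Rule (dtLang R) V)) : RelTRS (dtLang R) V where
  strict := S
  weak := (D \ S) ∪ embR R

/-! ### Parallel dependency tuples -/

/-- The positions of `t` with a defined symbol of `R`. -/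
def PosDef (t : L.Term V) : Set (List ℕ) :=
  {π | ∃ (n : ℕ) (f : L.Functions n) (ts : Fin n → L.Term V),
    subtermAt π t = some (.func f ts) ∧ f ∈ DefSyms R n}

/-- `⟨π₁, …, πₖ⟩` is a structural dependency chain for `t`: a list of positions with defined
symbols such that `π₁ > … > πₖ`. -/
def IsDepChain (t : L.Term V) (πs : List (List ℕ)) : Prop :=
  (∀ π ∈ πs, π ∈ PosDef R t) ∧ πs.Pairwise PosGT

/-- Maximality of a structural dependency chain. -/
def IsMaximalFor (t : L.Term V) : List (List ℕ) → Prop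
  | [] => PosDef R t = ∅
  | π₁ :: πs => ∀ π ∈ PosDef R t, ¬ PosGT π π₁ ∧ (PosGT π₁ π → π ∈ πs)

/-- The set of maximal structural dependency chains for `t`. -/
def MSDC (t : L.Term V) : Set (List (List ℕ)) :=
  {πs | IsDepChain R t πs ∧ IsMaximalFor R t πs}

/-- The parallel dependency tuples `ℓ♯ → Com_k((r|π₁)♯, …, (r|πₖ)♯)` of the rules `ℓ → r` of `R`,
one for each maximal structural dependency chain `⟨π₁, …, πₖ⟩` for `r`. -/
def PDT : Set (Rule (dtLang R) V) :=
  {ρ' | ∃ ρ ∈ R, ∃ πs ∈ MSDC R ρ.rhs, ∃ us : Fin πs.length → L.Term V,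
    (∀ i, subtermAt (πs.get i) ρ.rhs = some (us i)) ∧
    ρ' = ⟨sharp R (emb R ρ.lhs), com R fun i => sharp R (emb R (us i))⟩}

end DT

/-! ### Type assignments -/

/-- A many-sorted, first-order, monomorphic type assignment with set of sorts `Srt`: the argument
sorts and the result sort of every function symbol. -/
structure TypeAssignment (L : FirstOrder.Language.{u, u'}) (Srt : Type w) where
  dom : ∀ {n : ℕ}, L.Functions n → Fin n → Srt
  cod : ∀ {n : ℕ}, L.Functions n → Srt

/-- `t` is well typed of sort `τ`, where the variables have the sorts given by `Γ`. -/
def HasSort {L : FirstOrder.Language.{u, u'}} {Srt : Type w} {V : Type v} (Θ : TypeAssignment L Srt)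
    (Γ : V → Srt) : L.Term V → Srt → Prop
  | .var x, τ => Γ x = τ
  | .func f ts, τ => Θ.cod f = τ ∧ ∀ i, HasSort Θ Γ (ts i) (Θ.dom f i)

/-- `t` is well typed, for some choice of the sorts of the variables. -/
def WellTyped {L : FirstOrder.Language.{u, u'}} {Srt : Type w} {V : Type v} (Θ : TypeAssignment L Srt)
    (t : L.Term V) : Prop :=
  ∃ (Γ : V → Srt) (τ : Srt), HasSort Θ Γ t τ

/-- Both sides of `ρ` are well typed and have the same sort, for a common choice of the sorts of
the variables. -/
def RuleWellTyped {L : FirstOrder.Language.{u, u'}} {Srt : Type w} {V : Type v} (Θ : TypeAssignment L Srt)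
    (ρ : Rule L V) : Prop :=
  ∃ (Γ : V → Srt) (τ : Srt), HasSort Θ Γ ρ.lhs τ ∧ HasSort Θ Γ ρ.rhs τ

/-- The two sorts. -/
inductive TwoSort
  | bot
  | dt

/-- The shape of the two-sorted type assignment: original symbols have type
`bot × … × bot → bot`, sharp symbols have type `bot × … × bot → dt`, and compound symbols have type
`dt × … × dt → dt`. -/
structure IsDTTyping {L : FirstOrder.Language.{u, u'}} {V : Type v} (R : Set (Rule L V))
    (Θ : TypeAssignment (dtLang R) TwoSort) : Prop where
  base : ∀ (n : ℕ) (f : L.Functions n),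
    Θ.cod (n := n) (DTFunctions.base f) = .bot ∧
      ∀ i, Θ.dom (n := n) (DTFunctions.base f) i = .bot
  sharp : ∀ (n : ℕ) (f : L.Functions n) (hf : f ∈ DefSyms R n),
    Θ.cod (n := n) (DTFunctions.sharp f hf) = .dt ∧
      ∀ i, Θ.dom (n := n) (DTFunctions.sharp f hf) i = .bot
  com : ∀ n : ℕ,
    Θ.cod (n := n) (DTFunctions.com) = .dt ∧
      ∀ i, Θ.dom (n := n) (DTFunctions.com) i = .dt

end DepTuple

open DepTuple

/-!
A derivation of the relative rewrite system `S / ((D ∖ S) ∪ R)` is analysed from its end to its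
beginning.  All terms that are reachable from a basic term `f♯(ts)` are built with compound symbols
from terms `g♯(us)`, where the `us` are only rewritten with rules of `R`.  For a predicate `P s e`
on original terms `s` and numbers `e`, such a term is given a potential (`Potential`): a sum of
numbers `e`, at most one for each subterm `g♯(us)`, with `P (g(us')) e` for some `us'` to which the
`us` can be rewritten.  Going backwards along a step, the potential does not decrease, and it grows
by one for a step with a rule of `S` (`high_step`), provided that `P` satisfies one closure property
(`Contributes`): if `f(ls)♯ → Com(w₁♯, …, wₘ♯)` is a dependency tuple `ρ`, and `P` provides the
numbers `eᵢ` for calls to which the instances of the `wᵢ` can be rewritten, then it provides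
`δ + ∑ eᵢ` for the instance of `f(ls)`, where `δ` is `1` or `0` according to whether `ρ` is in `S`.
Hence the length of the derivation is bounded by a number that `P` provides for `f(ts)`
(`bound_of_iter`).  The predicate is instantiated twice.

* For the complexity of DT problems, `P s e` states that `s♯` has a chain tree with at least `e`
  nodes from `S`.  The closure property holds because chain trees for the calls become the children
  of a new root (`contributes_treeCount`).
* For parallel-innermost rewriting, `P s e` states that `s` has normal forms as arguments and starts
  a parallel-innermost sequence of length `e`.  The `wᵢ` are then nested subterms of a right-hand
  side, the innermost one first.  Once the steps of an inner call are done, confluence allows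
  continuing to the normal forms of the arguments of the next outer call (`iter_pito_add`), so
  that the lengths add up (`iter_pito_depChain`).  This uses that normal forms which are reachable by
  innermost rewriting are reachable by parallel-innermost rewriting (`star_pito_of_star`), which is
  proved with a big-step evaluation relation.

Basic terms over the extended signature need not be well typed.  Therefore all of the above is done
modulo an abstraction (`abstr`), which replaces the maximal subterms with sharp or compound symbols
at the root, below the root of the term, by variables.  These subterms are free of defined symbols,
so they are never rewritten; if the replacement is injective, then a term is an instance of its
abstraction, and so abstraction preserves normal forms (`nf_abstr`) as well as rewrite steps
(`low_step`).  As only finitely many subterms have to be replaced, the infinite set of variables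
suffices.
-/

namespace DepTuple

/-! ### Rewriting under substitutions and at subterms -/

section Rewriting

variable {L : FirstOrder.Language.{u, u'}} {V : Type v}

theorem subst_subst (t : L.Term V) (σ τ : V → L.Term V) :
    (t.subst σ).subst τ = t.subst fun x => (σ x).subst τ := by
  induction t with
  | var x => rfl
  | func f ts ih =>
    simp only [FirstOrder.Language.Term.subst]
    exact congrArg _ (funext ih)

theorem subst_var (t : L.Term V) : t.subst FirstOrder.Language.Term.var = t := by
  induction t with
  | var x => rfl
  | func f ts ih =>
    simp only [FirstOrder.Language.Term.subst]
    exact congrArg _ (funext ih)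

theorem map_update {n : ℕ} {α β : Type*} (g : α → β) (ts : Fin n → α) (i : Fin n) (t' : α) :
    (fun j => g (Function.update ts i t' j)) = Function.update (fun j => g (ts j)) i (g t') :=
  Function.comp_update g ts i t'

theorem Step.subst {R : Set (Rule L V)} {s t : L.Term V} (h : Step R s t) (τ : V → L.Term V) :
    Step R (s.subst τ) (t.subst τ) := by
  induction h with
  | root ρ hρ σ =>
    rw [subst_subst, subst_subst]
    exact Step.root ρ hρ _
  | arg f ts i t' _ ih =>
    simp only [FirstOrder.Language.Term.subst]
    rw [map_update (fun t : L.Term V => t.subst τ)]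
    exact Step.arg f _ i _ ih

theorem Step.mono {R R' : Set (Rule L V)} (hR : R ⊆ R') {s t : L.Term V} (h : Step R s t) :
    Step R' s t := by
  induction h with
  | root ρ hρ σ => exact Step.root ρ (hR hρ) _
  | arg f ts i t' _ ih => exact Step.arg f _ i _ ih

theorem NF.anti {R R' : Set (Rule L V)} (hR : R ⊆ R') {t : L.Term V} (h : NF R' t) : NF R t :=
  fun ⟨t', ht⟩ => h ⟨t', ht.mono hR⟩

theorem NF.of_subst {R : Set (Rule L V)} {t : L.Term V} {τ : V → L.Term V}
    (h : NF R (t.subst τ)) : NF R t :=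
  fun ⟨_, ht⟩ => h ⟨_, ht.subst τ⟩

theorem IStep.step {N A : Set (Rule L V)} {s t : L.Term V} (h : IStep N A s t) : Step A s t := by
  induction h with
  | root ρ hρ σ => exact Step.root ρ hρ _
  | arg f ts i t' _ ih => exact Step.arg f _ i _ ih

theorem Step.func_inv {R : Set (Rule L V)} {n : ℕ} {f : L.Functions n} {ts : Fin n → L.Term V}
    {t : L.Term V} (h : Step R (.func f ts) t) :
    (∃ ρ ∈ R, ∃ σ : V → L.Term V, .func f ts = ρ.lhs.subst σ ∧ t = ρ.rhs.subst σ) ∨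
      ∃ i t', Step R (ts i) t' ∧ t = .func f (Function.update ts i t') := by
  generalize hs : FirstOrder.Language.Term.func f ts = s at h
  cases h with
  | root ρ hρ σ => exact .inl ⟨ρ, hρ, σ, rfl, rfl⟩
  | arg f' ts' i t' h =>
    cases hs
    exact .inr ⟨i, t', h, rfl⟩

theorem properSubterm_func_iff {n : ℕ} {f : L.Functions n} {ts : Fin n → L.Term V}
    {u : L.Term V} :
    ProperSubterm u (.func f ts) ↔ ∃ i π, subtermAt π (ts i) = some u := by
  constructor
  · rintro ⟨π, hπ, h⟩
    cases π with
    | nil => exact absurd rfl hπ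
    | cons i π =>
      simp only [subtermAt] at h
      split_ifs at h with hi
      exact ⟨⟨i, hi⟩, π, h⟩
  · rintro ⟨i, π, h⟩
    refine ⟨i :: π, by simp, ?_⟩
    simp [subtermAt, h]

theorem Step.of_subtermAt {R : Set (Rule L V)} {u u' : L.Term V} (h : Step R u u') :
    ∀ {π : List ℕ} {t : L.Term V}, subtermAt π t = some u → ∃ t', Step R t t'
  | [], t, ht => by
    simp only [subtermAt, Option.some.injEq] at ht
    exact ⟨u', ht ▸ h⟩
  | _ :: _, .var _, ht => by simp [subtermAt] at ht
  | i :: π, .func f ts, ht => by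
    simp only [subtermAt] at ht
    split_ifs at ht with hi
    obtain ⟨t', ht'⟩ := Step.of_subtermAt h ht
    exact ⟨_, Step.arg f ts _ t' ht'⟩

theorem NF.subtermAt {R : Set (Rule L V)} {t u : L.Term V} (h : NF R t) {π : List ℕ}
    (hu : subtermAt π t = some u) : NF R u :=
  fun ⟨_, hs⟩ => h (hs.of_subtermAt hu)

theorem properSubterms_nf_iff {R : Set (Rule L V)} {n : ℕ} {f : L.Functions n}
    {ts : Fin n → L.Term V} :
    (∀ u, ProperSubterm u (.func f ts) → NF R u) ↔ ∀ i, NF R (ts i) := by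
  constructor
  · exact fun h i => h _ (properSubterm_func_iff.2 ⟨i, [], by simp [DepTuple.subtermAt]⟩)
  · intro h u hu
    obtain ⟨i, π, hu⟩ := properSubterm_func_iff.1 hu
    exact (h i).subtermAt hu

theorem IStep.func_inv {N A : Set (Rule L V)} {n : ℕ} {f : L.Functions n}
    {ts : Fin n → L.Term V} {t : L.Term V} (h : IStep N A (.func f ts) t) :
    (∃ ρ ∈ A, ∃ σ : V → L.Term V, .func f ts = ρ.lhs.subst σ ∧ t = ρ.rhs.subst σ ∧
        ∀ i, NF N (ts i)) ∨
      ∃ i t', IStep N A (ts i) t' ∧ t = .func f (Function.update ts i t') := by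
  generalize hs : FirstOrder.Language.Term.func f ts = s at h
  cases h with
  | root ρ hρ σ hN =>
    refine .inl ⟨ρ, hρ, σ, rfl, rfl, ?_⟩
    rw [← hs] at hN
    exact properSubterms_nf_iff.1 hN
  | arg f' ts' i t' h =>
    cases hs
    exact .inr ⟨i, t', h, rfl⟩

theorem IStep.root_of_eq {N A : Set (Rule L V)} {n : ℕ} {f : L.Functions n}
    {ts : Fin n → L.Term V} {ρ : Rule L V} (hρ : ρ ∈ A) {σ : V → L.Term V}
    (h : .func f ts = ρ.lhs.subst σ) (hN : ∀ i, NF N (ts i)) :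
    IStep N A (.func f ts) (ρ.rhs.subst σ) := by
  rw [h]
  refine IStep.root ρ hρ σ ?_
  rw [← h]
  exact properSubterms_nf_iff.2 hN

theorem NF.func_arg {R : Set (Rule L V)} {n : ℕ} {f : L.Functions n} {ts : Fin n → L.Term V}
    (h : NF R (.func f ts)) (i : Fin n) : NF R (ts i) :=
  fun ⟨_, hs⟩ => h ⟨_, Step.arg f ts i _ hs⟩

/-- Relates two terms with the same root symbol when the arguments of the first one rewrite
innermost to those of the second one. -/
def ArgsRewrite (R : Set (Rule L V)) (s t : L.Term V) : Prop :=
  ∃ (n : ℕ) (f : L.Functions n) (ss ts : Fin n → L.Term V), s = .func f ss ∧ t = .func f ts ∧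
    ∀ i, Relation.ReflTransGen (Ito R) (ss i) (ts i)

theorem IStep.star_update {N A : Set (Rule L V)} {n : ℕ} (f : L.Functions n)
    (ss : Fin n → L.Term V) (i : Fin n) {t : L.Term V}
    (h : Relation.ReflTransGen (IStep N A) (ss i) t) :
    Relation.ReflTransGen (IStep N A) (.func f ss) (.func f (Function.update ss i t)) := by
  induction h with
  | refl => rw [Function.update_eq_self]
  | tail _ h ih =>
    refine ih.tail ?_
    have := IStep.arg f (Function.update ss i _) i _ (by simpa using h)
    simpa using this

theorem IStep.star_args {N A : Set (Rule L V)} {n : ℕ} (f : L.Functions n)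
    {ss ts : Fin n → L.Term V} (h : ∀ i, Relation.ReflTransGen (IStep N A) (ss i) (ts i)) :
    Relation.ReflTransGen (IStep N A) (.func f ss) (.func f ts) := by
  classical
  have key : ∀ F : Finset (Fin n), Relation.ReflTransGen (IStep N A) (.func f ss)
      (.func f fun j => if j ∈ F then ts j else ss j) := by
    intro F
    induction F using Finset.induction_on with
    | empty => simpa using Relation.ReflTransGen.refl
    | insert a F ha ih =>
      have := IStep.star_update f (fun j => if j ∈ F then ts j else ss j) a (t := ts a)
        (by simpa [ha] using h a)
      refine ih.trans ?_
      convert this using 2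
      funext j
      by_cases hj : j = a
      · subst hj; simp
      · simp [hj]
  simpa using key Finset.univ

theorem IStep.trans_args {N A : Set (Rule L V)} {n : ℕ} (f : L.Functions n)
    {ss ts : Fin n → L.Term V} (h : ∀ i, Relation.ReflTransGen (IStep N A) (ss i) (ts i))
    (i : Fin n) (hi : Relation.TransGen (IStep N A) (ss i) (ts i)) :
    Relation.TransGen (IStep N A) (.func f ss) (.func f ts) := by
  obtain ⟨u, hu, hut⟩ := Relation.TransGen.head'_iff.1 hi
  refine Relation.TransGen.head' (IStep.arg f ss i u hu) (IStep.star_args f fun j => ?_)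
  by_cases hj : j = i
  · subst hj; simpa using hut
  · simpa [hj] using h j

theorem star_eq_of_nf {R : Set (Rule L V)} {s t : L.Term V}
    (h : Relation.ReflTransGen (Ito R) s t) (hs : NF R s) : t = s := by
  obtain rfl | ⟨u, hu, -⟩ := Relation.ReflTransGen.cases_head h
  · rfl
  · exact absurd ⟨_, hu.step⟩ hs

theorem subtermAt_append : ∀ (π τ : List ℕ) (t : L.Term V),
    subtermAt (π ++ τ) t = (subtermAt π t).bind (subtermAt τ)
  | [], τ, t => by simp [subtermAt]
  | _ :: _, τ, .var _ => by simp [subtermAt]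
  | i :: π, τ, .func f ts => by
    simp only [List.cons_append, subtermAt]
    split_ifs with hi
    · exact subtermAt_append π τ _
    · rfl

theorem subtermAt_subst (σ : V → L.Term V) : ∀ {π : List ℕ} {t u : L.Term V},
    subtermAt π t = some u → subtermAt π (t.subst σ) = some (u.subst σ)
  | [], t, u, h => by
    simp only [subtermAt, Option.some.injEq] at h ⊢
    rw [h]
  | _ :: _, .var _, _, h => by simp [subtermAt] at h
  | i :: π, .func f ts, u, h => by
    simp only [subtermAt, FirstOrder.Language.Term.subst] at h ⊢
    split_ifs at h ⊢ with hi
    exact subtermAt_subst σ h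

theorem tvars_subtermAt : ∀ {π : List ℕ} {t u : L.Term V},
    subtermAt π t = some u → tvars u ⊆ tvars t
  | [], t, u, h => by
    simp only [subtermAt, Option.some.injEq] at h
    rw [h]
  | _ :: _, .var _, _, h => by simp [subtermAt] at h
  | i :: π, .func f ts, u, h => by
    simp only [subtermAt] at h
    split_ifs at h with hi
    simp only [tvars]
    exact (tvars_subtermAt h).trans (Set.subset_iUnion (fun j => tvars (ts j)) ⟨i, hi⟩)

end Rewriting

section Iterates

variable {α : Type*} {r : α → α → Prop}

theorem iter_add {a b : ℕ} {s t u : α} (h : iter r a s t) (h' : iter r b t u) :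
    iter r (a + b) s u := by
  induction a generalizing s with
  | zero => cases h; simpa using h'
  | succ a ih =>
    obtain ⟨w, hw, h⟩ := h
    rw [Nat.succ_add]
    exact ⟨w, hw, ih h⟩

theorem iter_le {a b : ℕ} (hab : a ≤ b) {s t : α} (h : iter r b s t) : ∃ t', iter r a s t' := by
  induction a generalizing b s with
  | zero => exact ⟨s, rfl⟩
  | succ a ih =>
    obtain ⟨b, rfl⟩ : ∃ c, b = c + 1 := ⟨b - 1, by omega⟩
    obtain ⟨w, hw, h⟩ := h
    obtain ⟨t', ht'⟩ := ih (by omega) h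
    exact ⟨t', w, hw, ht'⟩

theorem exists_iter {s t : α} (h : Relation.ReflTransGen r s t) : ∃ a, iter r a s t := by
  induction h using Relation.ReflTransGen.head_induction_on with
  | refl => exact ⟨0, rfl⟩
  | head h _ ih =>
    obtain ⟨a, ha⟩ := ih
    exact ⟨a + 1, _, h, ha⟩

theorem le_Dh {e : ℕ} {s t : α} (h : iter r e s t) : (e : ℕ∞) ≤ Dh r s :=
  le_iSup₂_of_le e ⟨t, h⟩ le_rfl

theorem Dh_le {s : α} {x : ℕ∞} (h : ∀ e t, iter r e s t → (e : ℕ∞) ≤ x) : Dh r s ≤ x :=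
  iSup₂_le fun e ⟨t, ht⟩ => h e t ht

end Iterates

/-! ### Parallel-innermost rewriting -/

section Parallel

variable {L : FirstOrder.Language.{u, u'}} {V : Type v} {R : Set (Rule L V)}

theorem Pito.transGen {s t : L.Term V} (h : Pito R s t) : Relation.TransGen (Ito R) s t := by
  cases s with
  | var x => simp only [Pito] at h; exact h.1
  | func f ss => rw [Pito] at h; exact h.1

theorem NF.not_pito {s t : L.Term V} (hs : NF R s) : ¬ Pito R s t := by
  intro h
  obtain ⟨u, hu, -⟩ := Relation.TransGen.head'_iff.1 h.transGen
  exact hs ⟨_, hu.step⟩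

theorem star_pito_eq_of_nf {s t : L.Term V} (h : Relation.ReflTransGen (Pito R) s t)
    (hs : NF R s) : t = s := by
  obtain rfl | ⟨u, hu, -⟩ := Relation.ReflTransGen.cases_head h
  · rfl
  · exact absurd hu hs.not_pito

/-- One parallel-innermost step, or no change of a normal form: the relation between corresponding
arguments in a parallel-innermost step below the root. -/
def PitoOrNF (R : Set (Rule L V)) (s t : L.Term V) : Prop := Pito R s t ∨ (s = t ∧ NF R t)

theorem PitoOrNF.star {s t : L.Term V} (h : PitoOrNF R s t) :
    Relation.ReflTransGen (Pito R) s t := by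
  obtain h | ⟨rfl, -⟩ := h
  · exact .single h
  · exact .refl

theorem Pito.of_args {n : ℕ} (f : L.Functions n) {ss ts : Fin n → L.Term V}
    (h : ∀ i, PitoOrNF R (ss i) (ts i)) {i : Fin n} (hi : Pito R (ss i) (ts i)) :
    Pito R (.func f ss) (.func f ts) := by
  rw [Pito]
  refine ⟨IStep.trans_args f (fun j => ?_) i hi.transGen, .inr ⟨ts, rfl, h⟩⟩
  obtain h | ⟨h, -⟩ := h j
  · exact h.transGen.to_reflTransGen
  · rw [h]

theorem Pito.root {n : ℕ} {f : L.Functions n} {ss : Fin n → L.Term V} {ρ : Rule L V}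
    (hρ : ρ ∈ R) {σ : V → L.Term V} (h : .func f ss = ρ.lhs.subst σ) (hN : ∀ i, NF R (ss i)) :
    Pito R (.func f ss) (ρ.rhs.subst σ) := by
  have hstep : Ito R (.func f ss) (ρ.rhs.subst σ) := IStep.root_of_eq hρ h hN
  rw [Pito]
  exact ⟨.single hstep, .inl ⟨hstep, ⟨ρ, hρ, σ, h⟩, properSubterms_nf_iff.2 hN⟩⟩

theorem nf_var (hR : IsTRS R) (x : V) : NF R (.var x : L.Term V) := by
  rintro ⟨t, ht⟩
  generalize hs : (FirstOrder.Language.Term.var x : L.Term V) = s at ht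
  cases ht with
  | root ρ hρ σ =>
    cases hl : ρ.lhs with
    | var y => exact (hR ρ hρ).1 y hl
    | func f ts => rw [hl] at hs; cases hs
  | arg => cases hs

/-- A term that is not a normal form can always be rewritten in parallel. -/
theorem exists_pitoOrNF (hR : IsTRS R) (s : L.Term V) : ∃ t, PitoOrNF R s t := by
  induction s with
  | var x => exact ⟨_, .inr ⟨rfl, nf_var hR x⟩⟩
  | func f ss ih =>
    choose ts hts using ih
    by_cases hnf : NF R (.func f ss)
    · exact ⟨_, .inr ⟨rfl, hnf⟩⟩
    by_cases hargs : ∃ i, Pito R (ss i) (ts i)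
    · obtain ⟨i, hi⟩ := hargs
      exact ⟨_, .inl (Pito.of_args f hts hi)⟩
    have hN : ∀ i, NF R (ss i) := fun i => by
      obtain h | ⟨h, h'⟩ := hts i
      · exact absurd ⟨i, h⟩ hargs
      · exact h ▸ h'
    obtain ⟨t, ht⟩ := not_not.1 hnf
    obtain ⟨ρ, hρ, σ, hl, -⟩ | ⟨i, t', h, -⟩ := ht.func_inv
    · exact ⟨_, .inl (Pito.root hρ hl hN)⟩
    · exact absurd ⟨_, h⟩ (hN i)

theorem star_pito_args_step {n : ℕ} (f : L.Functions n) {ss ts : Fin n → L.Term V}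
    (h : ∀ i, PitoOrNF R (ss i) (ts i)) :
    Relation.ReflTransGen (Pito R) (.func f ss) (.func f ts) := by
  by_cases hargs : ∃ i, Pito R (ss i) (ts i)
  · obtain ⟨i, hi⟩ := hargs
    exact .single (Pito.of_args f h hi)
  · have : ss = ts := funext fun i => (h i).elim (fun h => absurd ⟨i, h⟩ hargs) (·.1)
    rw [this]

theorem iter_pitoOrNF_of_star {s t : L.Term V} (h : Relation.ReflTransGen (Pito R) s t)
    (ht : NF R t) : ∃ a, ∀ b, a ≤ b → iter (PitoOrNF R) b s t := by
  induction h using Relation.ReflTransGen.head_induction_on with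
  | refl =>
    refine ⟨0, fun b _ => ?_⟩
    induction b with
    | zero => rfl
    | succ b ih => exact ⟨t, .inr ⟨rfl, ht⟩, ih (Nat.zero_le _)⟩
  | head h _ ih =>
    obtain ⟨a, ha⟩ := ih
    refine ⟨a + 1, fun b hb => ?_⟩
    obtain ⟨b, rfl⟩ : ∃ c, b = c + 1 := ⟨b - 1, by omega⟩
    exact ⟨_, .inl h, ha b (by omega)⟩

/-- Arguments that reach normal forms do so simultaneously: those which are done earlier wait. -/
theorem star_pito_args {n : ℕ} (f : L.Functions n) {ss ts : Fin n → L.Term V}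
    (h : ∀ i, Relation.ReflTransGen (Pito R) (ss i) (ts i)) (hN : ∀ i, NF R (ts i)) :
    Relation.ReflTransGen (Pito R) (.func f ss) (.func f ts) := by
  choose a ha using fun i => iter_pitoOrNF_of_star (h i) (hN i)
  have hb : ∀ i, iter (PitoOrNF R) (∑ j, a j) (ss i) (ts i) := fun i =>
    ha i _ (Finset.single_le_sum (f := a) (fun _ _ => Nat.zero_le _) (Finset.mem_univ i))
  generalize ∑ j, a j = b at hb
  clear h ha
  induction b generalizing ss with
  | zero => rw [show ss = ts from funext hb]
  | succ b ih =>
    choose us hus hus' using hb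
    exact (star_pito_args_step f hus).trans (ih hus')

/-- Big-step innermost evaluation of a term to a normal form. -/
inductive Evaluates (R : Set (Rule L V)) : L.Term V → L.Term V → Prop
  | var (x : V) : Evaluates R (.var x) (.var x)
  | args {n : ℕ} (f : L.Functions n) (ss vs : Fin n → L.Term V)
      (h : ∀ i, Evaluates R (ss i) (vs i)) (hN : NF R (.func f vs)) :
      Evaluates R (.func f ss) (.func f vs)
  | root {n : ℕ} (f : L.Functions n) (ss vs : Fin n → L.Term V)
      (h : ∀ i, Evaluates R (ss i) (vs i)) (hN : ∀ i, NF R (vs i)) (ρ : Rule L V) (hρ : ρ ∈ R)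
      (σ : V → L.Term V) (hl : .func f vs = ρ.lhs.subst σ) (v : L.Term V)
      (hr : Evaluates R (ρ.rhs.subst σ) v) : Evaluates R (.func f ss) v

theorem Evaluates.refl : ∀ {t : L.Term V}, NF R t → Evaluates R t t
  | .var x, _ => .var x
  | .func f ts, h => .args f ts ts (fun i => Evaluates.refl (h.func_arg i)) h

theorem Evaluates.func_inv {n : ℕ} {f : L.Functions n} {ss : Fin n → L.Term V} {v : L.Term V}
    (h : Evaluates R (.func f ss) v) : ∃ vs : Fin n → L.Term V, (∀ i, Evaluates R (ss i) (vs i)) ∧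
      ∀ ss' : Fin n → L.Term V, (∀ i, Evaluates R (ss' i) (vs i)) → Evaluates R (.func f ss') v := by
  cases h with
  | args _ _ vs h hN => exact ⟨vs, h, fun ss' h' => .args f ss' vs h' hN⟩
  | root _ _ vs h hN ρ hρ σ hl v hr =>
    exact ⟨vs, h, fun ss' h' => .root f ss' vs h' hN ρ hρ σ hl v hr⟩

theorem Evaluates.head (hR : IsTRS R) {s t v : L.Term V} (h : Ito R s t)
    (ht : Evaluates R t v) : Evaluates R s v := by
  induction h generalizing v with
  | root ρ hρ σ hN =>
    cases hs : ρ.lhs with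
    | var y => exact absurd hs ((hR ρ hρ).1 y)
    | func f ts =>
      rw [hs] at hN
      have hN := properSubterms_nf_iff.1 hN
      exact .root f _ _ (fun i => .refl (hN i)) hN ρ hρ σ (by rw [hs]; rfl) v ht
  | arg f ts i t' _ ih =>
    obtain ⟨vs, hvs, hv⟩ := ht.func_inv
    refine hv ts fun j => ?_
    have := hvs j
    by_cases hj : j = i
    · subst hj
      exact ih (by simpa using this)
    · simpa [hj] using this

theorem Evaluates.of_star (hR : IsTRS R) {s v : L.Term V}
    (h : Relation.ReflTransGen (Ito R) s v) (hv : NF R v) : Evaluates R s v := by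
  induction h using Relation.ReflTransGen.head_induction_on with
  | refl => exact .refl hv
  | head h _ ih => exact ih.head hR h

theorem Evaluates.nf_and_star_pito (hR : IsTRS R) {s v : L.Term V} (h : Evaluates R s v) :
    NF R v ∧ Relation.ReflTransGen (Pito R) s v := by
  induction h with
  | var x => exact ⟨nf_var hR x, .refl⟩
  | args f ss vs _ hN ih => exact ⟨hN, star_pito_args f (fun i => (ih i).2) hN.func_arg⟩
  | root f ss vs _ hN ρ hρ σ hl v _ ih ih' =>
    exact ⟨ih'.1, ((star_pito_args f (fun i => (ih i).2) hN).tail (Pito.root hρ hl hN)).trans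
      ih'.2⟩

/-- Every normal form that is reachable by innermost rewriting is reachable by parallel-innermost
rewriting. -/
theorem star_pito_of_star (hR : IsTRS R) {s v : L.Term V}
    (h : Relation.ReflTransGen (Ito R) s v) (hv : NF R v) :
    Relation.ReflTransGen (Pito R) s v :=
  ((Evaluates.of_star hR h hv).nf_and_star_pito hR).2

/-- A parallel-innermost sequence of an argument extends to the whole term; the other arguments
are rewritten along with it as long as they are not normal forms. -/
theorem iter_pito_arg (hR : IsTRS R) {n : ℕ} (f : L.Functions n) (i : Fin n) {a : ℕ} :
    ∀ {ts : Fin n → L.Term V} {w : L.Term V}, iter (Pito R) a (ts i) w →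
      ∃ ws : Fin n → L.Term V, iter (Pito R) a (.func f ts) (.func f ws) ∧
        ∀ j, Relation.ReflTransGen (Pito R) (ts j) (ws j) := by
  induction a with
  | zero => exact fun {ts} _ _ => ⟨ts, rfl, fun _ => .refl⟩
  | succ a ih =>
    rintro ts w ⟨u, hu, hw⟩
    choose us hus using fun j => exists_pitoOrNF hR (ts j)
    have hus' : ∀ j, PitoOrNF R (ts j) (Function.update us i u j) := fun j => by
      by_cases hj : j = i
      · subst hj; exact .inl (by simpa using hu)
      · simpa [hj] using hus j
    obtain ⟨ws, hws, hws'⟩ := ih (ts := Function.update us i u) (by simpa using hw)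
    refine ⟨ws, ⟨_, Pito.of_args f hus' (i := i) (by simpa using hu), hws⟩, fun j => ?_⟩
    exact (hus' j).star.trans (hws' j)

theorem iter_pito_of_subtermAt (hR : IsTRS R) {a : ℕ} {u w : L.Term V}
    (h : iter (Pito R) a u w) : ∀ {π : List ℕ} {t : L.Term V}, subtermAt π t = some u →
      ∃ t', iter (Pito R) a t t'
  | [], t, ht => by
    simp only [subtermAt, Option.some.injEq] at ht
    exact ⟨w, ht ▸ h⟩
  | _ :: _, .var _, ht => by simp [subtermAt] at ht
  | i :: π, .func f ts, ht => by
    simp only [subtermAt] at ht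
    split_ifs at ht with hi
    obtain ⟨t', ht'⟩ := iter_pito_of_subtermAt hR h ht
    obtain ⟨ws, hws, -⟩ := iter_pito_arg hR f ⟨i, hi⟩ ht'
    exact ⟨_, hws⟩

/-- `s` is a term whose arguments are normal forms, and it starts a parallel-innermost sequence of
length `e`. -/
def PitoCall (R : Set (Rule L V)) (s : L.Term V) (e : ℕ) : Prop :=
  (∀ u, ProperSubterm u s → NF R u) ∧ ∃ t, iter (Pito R) e s t

/-- If `b` steps are possible after the evaluation of the arguments of `t`, and `a` steps are
possible inside an argument, then `a + b` steps are possible.  By confluence, the `a` steps can be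
continued until the arguments have their normal forms. -/
theorem iter_pito_add (hR : IsTRS R) (hC : Confluent (Pito R)) {t w : L.Term V} {b : ℕ}
    (htw : ArgsRewrite R t w) (hw : PitoCall R w b) {ts' : L.Term V} {a : ℕ}
    (ha : ∃ n, ∃ f : L.Functions n, ∃ ts ws : Fin n → L.Term V, t = .func f ts ∧ ts' = .func f ws ∧
      iter (Pito R) a t ts' ∧ ∀ j, Relation.ReflTransGen (Pito R) (ts j) (ws j)) :
    ∃ t', iter (Pito R) (a + b) t t' := by
  obtain ⟨n, f, ts, vs, rfl, rfl, hv⟩ := htw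
  obtain ⟨hN, t', ht'⟩ := hw
  obtain ⟨_, f', _, ws, h1, rfl, ha, hws⟩ := ha
  cases h1
  have hN := properSubterms_nf_iff.1 hN
  have hwv : ∀ j, Relation.ReflTransGen (Pito R) (ws j) (vs j) := fun j => by
    obtain ⟨z, hz, hz'⟩ := hC _ _ _ (hws j) (star_pito_of_star hR (hv j) (hN j))
    rwa [star_pito_eq_of_nf hz' (hN j)] at hz
  obtain ⟨k, hk⟩ := exists_iter (star_pito_args f hwv hN)
  exact iter_le (by omega) (iter_add (iter_add ha hk) ht')

theorem iter_pito_add_subtermAt (hR : IsTRS R) (hC : Confluent (Pito R)) {t u w u' : L.Term V}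
    {a b : ℕ} {π : List ℕ} (hπ : π ≠ []) (hu : subtermAt π t = some u)
    (ha : iter (Pito R) a u u') (hb : b = 0 ∨ ArgsRewrite R t w ∧ PitoCall R w b) :
    ∃ t', iter (Pito R) (a + b) t t' := by
  obtain rfl | ⟨htw, hw⟩ := hb
  · exact iter_pito_of_subtermAt hR ha hu
  obtain ⟨n, f, ts, vs, rfl, h⟩ := id htw
  cases π with
  | nil => exact absurd rfl hπ
  | cons i π =>
    simp only [subtermAt] at hu
    split_ifs at hu with hi
    obtain ⟨z, hz⟩ := iter_pito_of_subtermAt hR ha hu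
    obtain ⟨ws, hws, hws'⟩ := iter_pito_arg hR f ⟨i, hi⟩ hz
    exact iter_pito_add hR hC htw hw ⟨n, f, ts, ws, rfl, rfl, hws, hws'⟩

/-- Along a chain of nested subterms, the numbers of steps of the calls add up. -/
theorem iter_pito_chain (hR : IsTRS R) (hC : Confluent (Pito R)) (r : L.Term V)
    (σ : V → L.Term V) : ∀ (πs : List (List ℕ)) (π : List ℕ) (q w : L.Term V) (a : ℕ)
      (us : Fin πs.length → L.Term V) (es : Fin πs.length → ℕ), (π :: πs).Pairwise PosGT →
      subtermAt π r = some q → iter (Pito R) a (q.subst σ) w →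
      (∀ i, subtermAt (πs.get i) r = some (us i)) →
      (∀ i, es i = 0 ∨ ∃ w, ArgsRewrite R ((us i).subst σ) w ∧ PitoCall R w (es i)) →
      ∃ t', iter (Pito R) (a + ∑ i, es i) (r.subst σ) t'
  | [], π, q, w, a, us, es, _, hq, ha, _, _ => by
    simpa using iter_pito_of_subtermAt hR ha (subtermAt_subst σ hq)
  | π' :: πs, π, q, w, a, us, es, hπ, hq, ha, hus, hes => by
    have hus0 : subtermAt π' r = some (us ⟨0, by simp⟩) := hus ⟨0, by simp⟩
    obtain ⟨τ, hτ, hττ⟩ : PosGT π π' := (List.pairwise_cons.1 hπ).1 π' (by simp)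
    rw [← hττ, subtermAt_append, hus0, Option.bind_some] at hq
    have hstep : ∃ t', iter (Pito R) (a + es ⟨0, by simp⟩) ((us ⟨0, by simp⟩).subst σ) t' := by
      obtain h | ⟨w', hw', hc⟩ := hes ⟨0, by simp⟩
      · exact iter_pito_add_subtermAt (w := w) hR hC hτ (subtermAt_subst σ hq) ha (.inl h)
      · exact iter_pito_add_subtermAt hR hC hτ (subtermAt_subst σ hq) ha (.inr ⟨hw', hc⟩)
    obtain ⟨w', hw'⟩ := hstep
    have := iter_pito_chain hR hC r σ πs π' _ w' _ (fun i => us i.succ) (fun i => es i.succ)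
      (List.pairwise_cons.1 hπ).2 hus0 hw' (fun i => hus i.succ) (fun i => hes i.succ)
    have hsum : ∑ i, es i = es ⟨0, by simp⟩ + ∑ i : Fin πs.length, es i.succ :=
      Fin.sum_univ_succ (n := πs.length) es
    rw [hsum, ← add_assoc]
    exact this

theorem iter_pito_depChain (hR : IsTRS R) (hC : Confluent (Pito R)) (r : L.Term V)
    (σ : V → L.Term V) (πs : List (List ℕ)) (us : Fin πs.length → L.Term V)
    (es : Fin πs.length → ℕ) (hπ : πs.Pairwise PosGT)
    (hus : ∀ i, subtermAt (πs.get i) r = some (us i))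
    (hes : ∀ i, es i = 0 ∨ ∃ w, ArgsRewrite R ((us i).subst σ) w ∧ PitoCall R w (es i)) :
    ∃ t', iter (Pito R) (∑ i, es i) (r.subst σ) t' := by
  cases πs with
  | nil => exact ⟨r.subst σ, by simp [iter]⟩
  | cons π πs =>
    have hus0 : subtermAt π r = some (us ⟨0, by simp⟩) := hus ⟨0, by simp⟩
    have hstep : ∃ t', iter (Pito R) (es ⟨0, by simp⟩) ((us ⟨0, by simp⟩).subst σ) t' := by
      obtain h | ⟨w', hw', hc⟩ := hes ⟨0, by simp⟩
      · exact ⟨_, by rw [h]; rfl⟩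
      · obtain ⟨n, f, ts, vs, h1, h⟩ := id hw'
        have := iter_pito_add (a := 0) hR hC hw' hc ⟨n, f, ts, ts, h1, h1, rfl, fun _ => .refl⟩
        rwa [zero_add] at this
    obtain ⟨w', hw'⟩ := hstep
    have := iter_pito_chain hR hC r σ πs π _ w' _ (fun i => us i.succ) (fun i => es i.succ)
      hπ hus0 hw' (fun i => hus i.succ) (fun i => hes i.succ)
    have hsum : ∑ i, es i = es ⟨0, by simp⟩ + ∑ i : Fin πs.length, es i.succ :=
      Fin.sum_univ_succ (n := πs.length) es
    rwa [hsum]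

end Parallel

/-! ### Terms over the original and over the extended signature -/

section Abstraction

variable {L : FirstOrder.Language.{u, u'}} {V : Type v} {R : Set (Rule L V)}

/-- The term `f(ts)` of the extended signature, for an original symbol `f`. -/
abbrev baseApp (R : Set (Rule L V)) {n : ℕ} (f : L.Functions n)
    (ts : Fin n → (dtLang R).Term V) : (dtLang R).Term V :=
  FirstOrder.Language.Term.func (L := dtLang R) (DTFunctions.base f) ts

/-- The term `f♯(ts)`, for a defined symbol `f` of `R`. -/
abbrev sharpApp {n : ℕ} (f : L.Functions n) (hf : f ∈ DefSyms R n)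
    (ts : Fin n → (dtLang R).Term V) : (dtLang R).Term V :=
  FirstOrder.Language.Term.func (L := dtLang R) (DTFunctions.sharp f hf) ts

theorem emb_func {n : ℕ} (f : L.Functions n) (ts : Fin n → L.Term V) :
    emb R (.func f ts) = baseApp R f fun i => emb R (ts i) := rfl

theorem emb_subst (s : L.Term V) (σ : V → L.Term V) :
    (emb R s).subst (fun x => emb R (σ x)) = emb R (s.subst σ) := by
  induction s with
  | var x => rfl
  | func f ts ih => exact congrArg (baseApp R f) (funext ih)

theorem sharp_baseApp {n : ℕ} {f : L.Functions n} (hf : f ∈ DefSyms R n)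
    (ts : Fin n → (dtLang R).Term V) : sharp R (baseApp R f ts) = sharpApp f hf ts := by
  simp [sharp, hf]

theorem sharp_emb_func {n : ℕ} {f : L.Functions n} (hf : f ∈ DefSyms R n)
    (ts : Fin n → L.Term V) :
    sharp R (emb R (.func f ts)) = sharpApp f hf fun i => emb R (ts i) :=
  sharp_baseApp hf _

theorem tvars_emb (s : L.Term V) : tvars (emb R s) = tvars s := by
  induction s with
  | var x => rfl
  | func f ts ih => exact congrArg _ (funext ih)

/-- The abstraction of a term of the extended signature to the original one: every maximal subterm
`a` that is a variable or has a sharp or a compound symbol at its root is replaced by the variable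
`c a`. -/
def abstr (c : (dtLang R).Term V → V) : (dtLang R).Term V → L.Term V
  | .var x => .var (c (.var x))
  | .func (DTFunctions.base f) ts => .func f fun i => abstr c (ts i)
  | .func (DTFunctions.sharp f hf) ts => .var (c (sharpApp f hf ts))
  | .func DTFunctions.com ts => .var (c (com R ts))

/-- All the subterms of a term that `abstr` replaces by variables belong to `A`. -/
def Low (A : Set ((dtLang R).Term V)) : (dtLang R).Term V → Prop
  | .var x => .var x ∈ A
  | .func (DTFunctions.base _) ts => ∀ i, Low A (ts i)
  | .func (DTFunctions.sharp f hf) ts => sharpApp f hf ts ∈ A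
  | .func DTFunctions.com ts => com R ts ∈ A

theorem abstr_subst (c : (dtLang R).Term V → V) (s : L.Term V) (σ : V → (dtLang R).Term V) :
    abstr c ((emb R s).subst σ) = s.subst fun x => abstr c (σ x) := by
  induction s with
  | var x => rfl
  | func f ts ih => exact congrArg (FirstOrder.Language.Term.func f) (funext ih)

theorem low_subst_iff {A : Set ((dtLang R).Term V)} {s : L.Term V}
    {σ : V → (dtLang R).Term V} :
    Low A ((emb R s).subst σ) ↔ ∀ x ∈ tvars s, Low A (σ x) := by
  induction s with
  | var x => simp [tvars, emb, FirstOrder.Language.LHom.onTerm, FirstOrder.Language.Term.subst]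
  | func f ts ih =>
    have : Low A ((emb R (.func f ts)).subst σ) ↔ ∀ i, Low A ((emb R (ts i)).subst σ) := Iff.rfl
    simp only [this, ih, tvars, Set.mem_iUnion]
    exact ⟨fun h x ⟨i, hx⟩ => h i x hx, fun h i x hx => h x ⟨i, hx⟩⟩

theorem emb_abstr_subst {A : Set ((dtLang R).Term V)} {c : (dtLang R).Term V → V}
    {θ : V → (dtLang R).Term V} (hθ : ∀ a ∈ A, θ (c a) = a) :
    ∀ {s : (dtLang R).Term V}, Low A s → (emb R (abstr c s)).subst θ = s
  | .var _, h => hθ _ h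
  | .func (DTFunctions.base f) _, h =>
    congrArg (baseApp R f) (funext fun i => emb_abstr_subst hθ (h i))
  | .func (DTFunctions.sharp _ _) _, h => hθ _ h
  | .func DTFunctions.com _, h => hθ _ h

theorem Step.emb {s t : L.Term V} (h : Step R s t) : Step (embR R) (emb R s) (emb R t) := by
  induction h with
  | root ρ hρ σ =>
    rw [← emb_subst, ← emb_subst]
    exact Step.root (R := embR R) ⟨DepTuple.emb R ρ.lhs, DepTuple.emb R ρ.rhs⟩ ⟨ρ, hρ, rfl⟩ _
  | arg f ts i t' _ ih =>
    rw [emb_func, emb_func, map_update (DepTuple.emb R)]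
    exact Step.arg (L := dtLang R) (DTFunctions.base f) _ i _ ih

/-- Abstraction preserves normal forms, because a term is an instance of its abstraction. -/
theorem nf_abstr {Q : Set (Rule (dtLang R) V)} (hQ : embR R ⊆ Q) {A : Set ((dtLang R).Term V)}
    {c : (dtLang R).Term V → V} {θ : V → (dtLang R).Term V} (hθ : ∀ a ∈ A, θ (c a) = a)
    {s : (dtLang R).Term V} (hs : Low A s) (h : NF Q s) : NF R (abstr c s) := by
  rintro ⟨t, ht⟩
  rw [← emb_abstr_subst hθ hs] at h
  exact (h.anti hQ).of_subst ⟨_, ht.emb⟩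

open Classical in
/-- The name of a variable, with an arbitrary value at the other terms. -/
noncomputable def varName [Nonempty V] (s : (dtLang R).Term V) : V :=
  if h : ∃ x : V, s = .var x then h.choose else Classical.arbitrary V

theorem varName_var [Nonempty V] (x : V) : varName (R := R) (.var x) = x := by
  have h : ∃ y : V, (FirstOrder.Language.Term.var x : (dtLang R).Term V) = .var y := ⟨x, rfl⟩
  rw [varName, dif_pos h]
  have := h.choose_spec
  injection this with this
  exact this.symm

theorem abstr_varName_emb [Nonempty V] (s : L.Term V) : abstr varName (emb R s) = s := by
  induction s with
  | var x => exact congrArg FirstOrder.Language.Term.var (varName_var x)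
  | func f ts ih => exact congrArg (FirstOrder.Language.Term.func f) (funext ih)

theorem nf_emb [Nonempty V] {s : L.Term V} (h : NF R s) : NF (embR R) (emb R s) := by
  have hroot : ∀ {s : L.Term V}, NF R s → ∀ ρ ∈ R, ∀ σ : V → (dtLang R).Term V,
      emb R s ≠ (emb R ρ.lhs).subst σ := fun h ρ hρ σ hl => by
    have := congrArg (abstr varName) hl
    rw [abstr_varName_emb, abstr_subst] at this
    exact h ⟨_, this ▸ Step.root ρ hρ _⟩
  induction s with
  | var x =>
    rintro ⟨t, ht⟩
    generalize hs : emb R (.var x) = s' at ht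
    cases ht with
    | root ρ hρ σ =>
      obtain ⟨ρ, hρ, rfl⟩ := hρ
      exact hroot h ρ hρ σ hs
    | arg => cases hs
  | func f ts ih =>
    rintro ⟨t, ht⟩
    rw [emb_func] at ht
    obtain ⟨_, ⟨ρ, hρ, rfl⟩, σ, hl, -⟩ | ⟨i, t', ht', -⟩ := ht.func_inv
    · exact hroot h ρ hρ σ hl
    · exact ih i (h.func_arg i) ⟨_, ht'⟩

theorem IStep.emb [Nonempty V] (hR : IsTRS R) {s t : L.Term V} (h : Ito R s t) :
    Ito (embR R) (emb R s) (emb R t) := by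
  induction h with
  | root ρ hρ σ hN =>
    rw [← emb_subst, ← emb_subst]
    refine IStep.root (A := embR R) ⟨DepTuple.emb R ρ.lhs, DepTuple.emb R ρ.rhs⟩ ⟨ρ, hρ, rfl⟩ _ ?_
    cases hl : ρ.lhs with
    | var x => exact absurd hl ((hR ρ hρ).1 x)
    | func f ts =>
      rw [hl] at hN
      have hN := properSubterms_nf_iff.1 hN
      rw [emb_subst]
      exact properSubterms_nf_iff.2 fun i => nf_emb (hN i)
  | arg f ts i t' _ ih =>
    rw [emb_func, emb_func, map_update (DepTuple.emb R)]
    exact IStep.arg (L := dtLang R) (DTFunctions.base f) _ i _ ih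

end Abstraction

/-! ### Innermost rewriting with dependency tuples -/

section Potential

variable {L : FirstOrder.Language.{u, u'}} {V : Type v} {R : Set (Rule L V)}

theorem ConstructorTerm.nf {Q : Set (Rule L V)} (hQ : ∀ ρ ∈ Q, ∀ x, ρ.lhs ≠ .var x)
    {t : L.Term V} (ht : ConstructorTerm Q t) : NF Q t := by
  rintro ⟨t', h⟩
  induction h with
  | root ρ hρ σ =>
    cases hl : ρ.lhs with
    | var x => exact hQ ρ hρ x hl
    | func f ts =>
      rw [hl] at ht
      exact ht.1 ⟨ρ, hρ, ts, hl⟩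
  | arg f ts i t' _ ih => exact ih (ht.2 i)

theorem IsDT.lhs_rhs {ρ : Rule (dtLang R) V} (h : IsDT R ρ) :
    ∃ (n : ℕ) (f : L.Functions n) (hf : f ∈ DefSyms R n) (ls : Fin n → L.Term V) (m : ℕ)
      (ws : Fin m → L.Term V), ρ.lhs = sharpApp f hf (fun i => emb R (ls i)) ∧
      ρ.rhs = com R (fun i => sharp R (emb R (ws i))) ∧
      (∀ i, ∃ (k : ℕ) (g : L.Functions k) (ts : Fin k → L.Term V),
        g ∈ DefSyms R k ∧ ws i = .func g ts) ∧
      ∀ i, tvars (ws i) ⊆ ⋃ j, tvars (ls j) := by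
  obtain ⟨⟨n, f, ls, hf, hl⟩, ⟨m, vs, hvs, hr⟩, hv⟩ := h
  choose k g ts hg hvs using hvs
  refine ⟨n, f, hf, ls, m, fun i => .func (g i) (ts i), by rw [hl, sharp_emb_func hf], ?_,
    fun i => ⟨k i, g i, ts i, hg i, rfl⟩, fun i => ?_⟩
  · rw [hr]
    exact congrArg _ (funext hvs)
  · rw [VarCond, hl, hr, sharp_emb_func hf, com] at hv
    simp only [tvars, tvars_emb] at hv ⊢
    refine Set.Subset.trans ?_ ((Set.subset_iUnion (fun i => tvars (vs i)) i).trans hv)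
    rw [hvs, sharp_emb_func (hg i)]
    simp only [tvars, tvars_emb]
    exact subset_rfl

theorem lhs_ne_var (hR : IsTRS R) {D : Set (Rule (dtLang R) V)} (hD : ∀ ρ ∈ D, IsDT R ρ) :
    ∀ ρ ∈ D ∪ embR R, ∀ x, ρ.lhs ≠ .var x := by
  rintro ρ (hρ | ⟨ρ, hρ, rfl⟩) x hx
  · obtain ⟨n, f, hf, ls, -, -, hl, -⟩ := (hD ρ hρ).lhs_rhs
    rw [hl] at hx
    cases hx
  · cases hl : ρ.lhs with
    | var y => exact (hR ρ hρ).1 y hl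
    | func f ts =>
      dsimp only at hx
      rw [hl] at hx
      cases hx

theorem embR_lhs (hR : IsTRS R) {ρ : Rule (dtLang R) V} (hρ : ρ ∈ embR R) :
    ∃ (n : ℕ) (f : L.Functions n) (ls : Fin n → L.Term V), f ∈ DefSyms R n ∧
      ρ.lhs = baseApp R f fun i => emb R (ls i) := by
  obtain ⟨ρ, hρ, rfl⟩ := hρ
  cases hl : ρ.lhs with
  | var y => exact absurd hl ((hR ρ hρ).1 y)
  | func f ts => exact ⟨_, f, ts, ⟨ρ, hρ, ts, hl⟩, rfl⟩

variable {D X : Set (Rule (dtLang R) V)} {A : Set ((dtLang R).Term V)}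
  {c : (dtLang R).Term V → V} {θ : V → (dtLang R).Term V}

/-- Terms without defined sharp symbols outside of the subterms in `A` are only rewritten with rules
of `R`, and their abstractions can follow. -/
theorem low_step (hR : IsTRS R) (hD : ∀ ρ ∈ D, IsDT R ρ) (hX : X ⊆ D ∪ embR R)
    (hA : ∀ a ∈ A, ConstructorTerm (D ∪ embR R) a) (hθ : ∀ a ∈ A, θ (c a) = a) :
    ∀ {s t : (dtLang R).Term V}, Low A s → IStep (D ∪ embR R) X s t →
      Low A t ∧ Ito R (abstr c s) (abstr c t) ∧ ∃ ρ ∈ X, ρ ∈ embR R := by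
  have hnf : ∀ {s t : (dtLang R).Term V}, s ∈ A → ¬ IStep (D ∪ embR R) X s t := fun hs h =>
    (hA _ hs).nf (lhs_ne_var hR hD) ⟨_, h.step.mono hX⟩
  intro s
  induction s with
  | var x => exact fun hs h => absurd h (hnf hs)
  | @func n g ss ih =>
    intro t hs h
    match g, hs, h with
    | DTFunctions.sharp f hf, hs, h => exact absurd h (hnf hs)
    | DTFunctions.com, hs, h => exact absurd h (hnf hs)
    | DTFunctions.base f, hs, h =>
      obtain ⟨ρ, hρ, σ, hl, rfl, hN⟩ | ⟨i, t', ht', rfl⟩ := h.func_inv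
      · obtain hρD | hρR := hX hρ
        · obtain ⟨_, _, _, _, -, -, hl', -⟩ := (hD ρ hρD).lhs_rhs
          rw [hl'] at hl
          injection hl with h1 h2
          subst h1
          cases eq_of_heq h2
        · obtain ⟨ρ', hρ', rfl⟩ := id hρR
          have hlow : Low A ((emb R ρ'.lhs).subst σ) := hl ▸ hs
          rw [low_subst_iff] at hlow
          refine ⟨low_subst_iff.2 fun x hx => hlow x ((hR ρ' hρ').2 hx), ?_, _, hρ, hρR⟩
          have hl := congrArg (abstr c) hl
          rw [abstr_subst] at hl ⊢
          exact IStep.root_of_eq hρ' hl fun i => nf_abstr Set.subset_union_right hθ (hs i) (hN i)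
      · obtain ⟨h1, h2, h3⟩ := ih i (hs i) ht'
        refine ⟨fun j => ?_, ?_, h3⟩
        · by_cases hj : j = i
          · subst hj; simpa using h1
          · simpa [hj] using hs j
        · have : abstr c (baseApp R f (Function.update ss i t')) =
              .func f (Function.update (fun j => abstr c (ss j)) i (abstr c t')) :=
            congrArg _ (map_update (abstr c) ss i t')
          rw [this]
          exact IStep.arg f (fun j => abstr c (ss j)) i _ h2

/-- Terms built with compound symbols from terms `f♯(ts)` where the `ts` satisfy `Low`. -/
inductive High (A : Set ((dtLang R).Term V)) : (dtLang R).Term V → Prop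
  | sharp {n : ℕ} (f : L.Functions n) (hf : f ∈ DefSyms R n) (ts : Fin n → (dtLang R).Term V)
      (h : ∀ i, Low A (ts i)) : High A (sharpApp f hf ts)
  | com {n : ℕ} (us : Fin n → (dtLang R).Term V) (h : ∀ i, High A (us i)) : High A (com R us)

/-- `Potential c P s e` says that `e` is a sum of numbers `e'`, at most one for each maximal sharp
subterm `f♯(ts)` of `s`, with `P (f(ts')) e'` for some terms `ts'` to which the abstractions of the
`ts` can be rewritten. -/
inductive Potential (c : (dtLang R).Term V → V) (P : L.Term V → ℕ → Prop) :
    (dtLang R).Term V → ℕ → Prop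
  | zero (s : (dtLang R).Term V) : Potential c P s 0
  | call {n : ℕ} (f : L.Functions n) (hf : f ∈ DefSyms R n) (ts : Fin n → (dtLang R).Term V)
      (w : L.Term V) (e : ℕ) (hw : ArgsRewrite R (.func f fun i => abstr c (ts i)) w)
      (hP : P w e) : Potential c P (sharpApp f hf ts) e
  | com {n : ℕ} (us : Fin n → (dtLang R).Term V) (es : Fin n → ℕ)
      (h : ∀ i, Potential c P (us i) (es i)) : Potential c P (com R us) (∑ i, es i)

variable {P : L.Term V → ℕ → Prop}

theorem Potential.sharp_inv {n : ℕ} {f : L.Functions n} {hf : f ∈ DefSyms R n}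
    {ts : Fin n → (dtLang R).Term V} {e : ℕ} (h : Potential c P (sharpApp f hf ts) e) :
    e = 0 ∨ ∃ w, ArgsRewrite R (.func f fun i => abstr c (ts i)) w ∧ P w e := by
  generalize hs : sharpApp f hf ts = s at h
  cases h with
  | zero => exact .inl rfl
  | call f' hf' ts' w e hw hP =>
    injection hs with h1 h2 h3
    subst h1
    cases eq_of_heq h2
    cases eq_of_heq h3
    exact .inr ⟨w, hw, hP⟩
  | com us es h =>
    injection hs with h1 h2
    subst h1
    cases eq_of_heq h2

theorem Potential.com_inv {n : ℕ} {us : Fin n → (dtLang R).Term V} {e : ℕ}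
    (h : Potential c P (DepTuple.com R us) e) :
    ∃ es : Fin n → ℕ, (∀ i, Potential c P (us i) (es i)) ∧ e = ∑ i, es i := by
  generalize hs : DepTuple.com R us = s at h
  cases h with
  | zero => exact ⟨fun _ => 0, fun i => .zero _, by simp⟩
  | call f' hf' ts' w e hw hP =>
    injection hs with h1 h2
    subst h1
    cases eq_of_heq h2
  | com us es h =>
    injection hs with h1 h2 h3
    subst h1
    cases eq_of_heq h3
    exact ⟨es, h, rfl⟩

/-- The dependency tuple `ρ`, of the form `f(ls)♯ → Com(w₁♯, …, wₘ♯)`, contributes `δ` to `P`: the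
numbers that `P` provides for the calls of the `wᵢ` add up with `δ` to a number for `f(ls)`. -/
def Contributes (P : L.Term V → ℕ → Prop) (δ : ℕ) (ρ : Rule (dtLang R) V) : Prop :=
  ∃ (n : ℕ) (f : L.Functions n) (hf : f ∈ DefSyms R n) (ls : Fin n → L.Term V) (m : ℕ)
    (ws : Fin m → L.Term V), ρ.lhs = sharpApp f hf (fun i => emb R (ls i)) ∧
    ρ.rhs = com R (fun i => sharp R (emb R (ws i))) ∧
    (∀ i, ∃ (k : ℕ) (g : L.Functions k) (ts : Fin k → L.Term V),
      g ∈ DefSyms R k ∧ ws i = .func g ts) ∧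
    (∀ i, tvars (ws i) ⊆ ⋃ j, tvars (ls j)) ∧
    ∀ (σ : V → L.Term V) (es : Fin m → ℕ), (∀ i, NF R ((ls i).subst σ)) →
      (∀ i, es i = 0 ∨ ∃ w, ArgsRewrite R ((ws i).subst σ) w ∧ P w (es i)) →
      P (.func f fun i => (ls i).subst σ) (δ + ∑ i, es i)

/-- The potential does not decrease when going backwards along a rewrite step, and it increases by
the contribution of the rule. -/
theorem high_step (hR : IsTRS R) (hD : ∀ ρ ∈ D, IsDT R ρ) (hX : X ⊆ D ∪ embR R)
    (hA : ∀ a ∈ A, ConstructorTerm (D ∪ embR R) a) (hθ : ∀ a ∈ A, θ (c a) = a)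
    {δ : ℕ} (hδ : ∀ ρ ∈ X, ρ ∈ embR R → δ = 0) (hP : ∀ ρ ∈ X, ρ ∈ D → Contributes P δ ρ)
    {s t : (dtLang R).Term V} (hs : High A s) (h : IStep (D ∪ embR R) X s t) :
    High A t ∧ ∀ e, Potential c P t e → Potential c P s (δ + e) := by
  induction hs generalizing t with
  | sharp f hf ss hss =>
    obtain ⟨ρ, hρ, σ, hl, rfl, hN⟩ | ⟨i, t', ht', rfl⟩ := h.func_inv
    · have hρD : ρ ∈ D := by
        obtain hρD | hρR := hX hρ
        · exact hρD
        · obtain ⟨_, _, _, _, hl'⟩ := embR_lhs hR hρR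
          rw [hl'] at hl
          injection hl with h1 h2
          subst h1
          cases eq_of_heq h2
      obtain ⟨n, f', hf', ls, m, ws, hl', hr, hws, hv, hP⟩ := hP ρ hρ hρD
      rw [hl'] at hl
      injection hl with h1 h2 h3
      subst h1
      cases eq_of_heq h2
      obtain rfl := eq_of_heq h3
      have hlow : ∀ j, ∀ x ∈ tvars (ls j), Low A (σ x) := fun j => low_subst_iff.1 (hss j)
      choose k g ts hg hwts using hws
      have hcom : ρ.rhs.subst σ =
          DepTuple.com R fun i => sharpApp (g i) (hg i) fun j => (emb R (ts i j)).subst σ := by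
        rw [hr]
        refine congrArg (DepTuple.com R) (funext fun i => ?_)
        dsimp only
        rw [hwts, sharp_emb_func (hg i)]
        rfl
      rw [hcom]
      refine ⟨.com _ fun i => .sharp _ _ _ fun j => low_subst_iff.2 fun x hx => ?_, ?_⟩
      · obtain ⟨j', hj'⟩ := Set.mem_iUnion.1 (hv i (a := x) (by
          rw [hwts]; simp only [tvars, Set.mem_iUnion]; exact ⟨j, hx⟩))
        exact hlow j' x hj'
      · intro e he
        obtain ⟨es, hes, rfl⟩ := he.com_inv
        have habs : ∀ i, abstr c ((emb R (ls i)).subst σ) = (ls i).subst fun x => abstr c (σ x) :=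
          fun i => abstr_subst c (ls i) σ
        refine .call f hf _ (.func f fun i => (ls i).subst fun x => abstr c (σ x)) _
          ⟨_, f, _, _, rfl, rfl, fun i => ?_⟩ (hP _ es (fun i => ?_) fun i => ?_)
        · rw [← habs]
        · rw [← habs]
          exact nf_abstr Set.subset_union_right hθ (hss i) (hN i)
        · obtain h | ⟨w, hw, hPw⟩ := (hes i).sharp_inv
          · exact .inl h
          · refine .inr ⟨w, ?_, hPw⟩
            rw [hwts]
            have : (FirstOrder.Language.Term.func (g i) (ts i)).subst (fun x => abstr c (σ x)) =
                .func (g i) fun j => abstr c ((emb R (ts i j)).subst σ) := by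
              simp only [abstr_subst, FirstOrder.Language.Term.subst]
            rwa [this]
    · obtain ⟨h1, h2, ρ, hρX, hρR⟩ := low_step hR hD hX hA hθ (hss i) ht'
      refine ⟨.sharp f hf _ fun j => ?_, fun e he => ?_⟩
      · by_cases hj : j = i
        · subst hj; simpa using h1
        · simpa [hj] using hss j
      · rw [hδ ρ hρX hρR, zero_add]
        obtain rfl | ⟨w, ⟨n, f', ss', ts, hw, rfl, hstar⟩, hPw⟩ := he.sharp_inv
        · exact .zero _
        · cases hw
          refine .call f hf _ _ _ ⟨_, f, _, ts, rfl, rfl, fun j => ?_⟩ hPw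
          by_cases hj : j = i
          · subst hj
            have := hstar j
            simp only [Function.update_self] at this
            exact .head h2 this
          · simpa [hj] using hstar j
  | @com n us hus ih =>
    obtain ⟨ρ, hρ, σ, hl, rfl, -⟩ | ⟨i, t', ht', rfl⟩ := h.func_inv
    · exfalso
      obtain hρD | hρR := hX hρ
      · obtain ⟨_, _, _, _, -, -, hl', -⟩ := (hD ρ hρD).lhs_rhs
        rw [hl'] at hl
        injection hl with h1 h2
        subst h1
        cases eq_of_heq h2
      · obtain ⟨_, _, _, _, hl'⟩ := embR_lhs hR hρR
        rw [hl'] at hl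
        injection hl with h1 h2
        subst h1
        cases eq_of_heq h2
    · obtain ⟨h1, h2⟩ := ih i ht'
      refine ⟨.com (Function.update us i t') fun j => ?_, fun e he => ?_⟩
      · by_cases hj : j = i
        · subst hj; simpa using h1
        · simpa [hj] using hus j
      · obtain ⟨es, hes, rfl⟩ := Potential.com_inv (us := Function.update us i t') he
        have hsum : δ + ∑ j, es j = ∑ j, Function.update es i (δ + es i) j := by
          rw [Finset.sum_update_of_mem (Finset.mem_univ i), add_assoc,
            ← Finset.add_sum_erase _ es (Finset.mem_univ i), Finset.sdiff_singleton_eq_erase]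
        rw [hsum]
        refine .com us _ fun j => ?_
        by_cases hj : j = i
        · subst hj
          have := hes j
          simp only [Function.update_self] at this ⊢
          exact h2 _ this
        · simpa [hj] using hes j

variable {S : Set (Rule (dtLang R) V)}

theorem relOf_strict_union_weak (hS : S ⊆ D) :
    (relOf R D S).strict ∪ (relOf R D S).weak = D ∪ embR R := by
  show S ∪ ((D \ S) ∪ embR R) = D ∪ embR R
  rw [← Set.union_assoc, Set.union_sdiff_cancel hS]

theorem dt_notMem_embR (hR : IsTRS R) {ρ : Rule (dtLang R) V} (h : IsDT R ρ) : ρ ∉ embR R := by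
  intro hρ
  obtain ⟨_, _, _, _, -, -, hl, -⟩ := h.lhs_rhs
  obtain ⟨_, _, _, _, hl'⟩ := embR_lhs hR hρ
  rw [hl'] at hl
  injection hl with h1 h2
  subst h1
  cases eq_of_heq h2

theorem low_relIto (h : IsDTProblem R D S) (hA : ∀ a ∈ A, ConstructorTerm (D ∪ embR R) a)
    (hθ : ∀ a ∈ A, θ (c a) = a) {s t : (dtLang R).Term V} (hs : Low A s) :
    ¬ RelIto (relOf R D S) s t := by
  rintro ⟨s', s'', h1, h2, -⟩
  rw [relOf_strict_union_weak h.sub] at h1 h2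
  have hweak : (relOf R D S).weak ⊆ D ∪ embR R :=
    Set.union_subset_union_left _ Set.sdiff_subset
  have hstrict : (relOf R D S).strict ⊆ D ∪ embR R := h.sub.trans Set.subset_union_left
  have hs' : Low A s' := by
    clear h2
    induction h1 with
    | refl => exact hs
    | tail _ hst ih => exact (low_step h.trs h.dt hweak hA hθ ih hst).1
  obtain ⟨-, -, ρ, hρ, hρR⟩ := low_step h.trs h.dt hstrict hA hθ hs' h2
  exact dt_notMem_embR h.trs (h.dt ρ (h.sub hρ)) hρR

theorem high_relIto (h : IsDTProblem R D S) (hA : ∀ a ∈ A, ConstructorTerm (D ∪ embR R) a)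
    (hθ : ∀ a ∈ A, θ (c a) = a) (hPS : ∀ ρ ∈ S, Contributes P 1 ρ)
    (hPW : ∀ ρ ∈ D \ S, Contributes P 0 ρ) {s t : (dtLang R).Term V} (hs : High A s)
    (hst : RelIto (relOf R D S) s t) :
    High A t ∧ ∀ e, Potential c P t e → Potential c P s (1 + e) := by
  obtain ⟨s', s'', h1, h2, h3⟩ := hst
  rw [relOf_strict_union_weak h.sub] at h1 h2 h3
  have hweak : (relOf R D S).weak ⊆ D ∪ embR R :=
    Set.union_subset_union_left _ Set.sdiff_subset
  have hstrict : (relOf R D S).strict ⊆ D ∪ embR R := h.sub.trans Set.subset_union_left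
  have key : ∀ {s t : (dtLang R).Term V}, High A s →
      Relation.ReflTransGen (IStep (D ∪ embR R) (relOf R D S).weak) s t →
      High A t ∧ ∀ e, Potential c P t e → Potential c P s e := by
    intro s t hs hst
    induction hst with
    | refl => exact ⟨hs, fun _ => id⟩
    | tail _ hst ih =>
      obtain ⟨ih1, ih2⟩ := ih
      have := high_step (δ := 0) h.trs h.dt hweak hA hθ (fun _ _ _ => rfl) (fun ρ hρ hρD =>
        hρ.elim (hPW ρ) fun hρR => absurd hρR (dt_notMem_embR h.trs (h.dt ρ hρD))) ih1 hst
      exact ⟨this.1, fun e he => ih2 e (by simpa using this.2 e he)⟩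
  obtain ⟨k1, k2⟩ := key hs h1
  obtain ⟨k3, k4⟩ := high_step (δ := 1) h.trs h.dt hstrict hA hθ
    (fun ρ hρ hρR => absurd hρR (dt_notMem_embR h.trs (h.dt ρ (h.sub hρ))))
    (fun ρ hρ _ => hPS ρ hρ) k1 h2
  obtain ⟨k5, k6⟩ := key k3 h3
  exact ⟨k5, fun e he => k2 _ (k4 _ (k6 _ he))⟩

theorem potential_of_iter (h : IsDTProblem R D S)
    (hA : ∀ a ∈ A, ConstructorTerm (D ∪ embR R) a)
    (hθ : ∀ a ∈ A, θ (c a) = a) (hPS : ∀ ρ ∈ S, Contributes P 1 ρ)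
    (hPW : ∀ ρ ∈ D \ S, Contributes P 0 ρ) {e : ℕ} {s t : (dtLang R).Term V} (hs : High A s)
    (hst : iter (RelIto (relOf R D S)) e s t) : Potential c P s e := by
  induction e generalizing s with
  | zero => exact .zero s
  | succ e ih =>
    obtain ⟨w, hw, hwt⟩ := hst
    obtain ⟨h1, h2⟩ := high_relIto h hA hθ hPS hPW hs hw
    rw [add_comm]
    exact h2 e (ih h1 hwt)

theorem defSyms_cases (hR : IsTRS R) (hD : ∀ ρ ∈ D, IsDT R ρ) {n : ℕ}
    {g : (dtLang R).Functions n} (hg : g ∈ DefSyms (D ∪ embR R) n) :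
    ∃ f : L.Functions n, ∃ hf : f ∈ DefSyms R n, g = DTFunctions.base f ∨
      g = DTFunctions.sharp f hf := by
  obtain ⟨ρ, hρ | hρ, ts, hl⟩ := hg
  · obtain ⟨_, f, hf, _, -, -, hl', -⟩ := (hD ρ hρ).lhs_rhs
    rw [hl'] at hl
    injection hl with h1 h2
    subst h1
    exact ⟨f, hf, .inr (eq_of_heq h2).symm⟩
  · obtain ⟨_, f, _, hf, hl'⟩ := embR_lhs hR hρ
    rw [hl'] at hl
    injection hl with h1 h2
    subst h1
    exact ⟨f, hf, .inl (eq_of_heq h2).symm⟩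

/-- Derivations from a basic term `f♯(ts)` are bounded by `P (f(ts'))`, with the abstractions `ts'`
of the `ts`; the other basic terms have no derivations. -/
theorem bound_of_iter (h : IsDTProblem R D S) (hA : ∀ a ∈ A, ConstructorTerm (D ∪ embR R) a)
    (hθ : ∀ a ∈ A, θ (c a) = a) (hPS : ∀ ρ ∈ S, Contributes P 1 ρ)
    (hPW : ∀ ρ ∈ D \ S, Contributes P 0 ρ) {e : ℕ} {n : ℕ} {g : (dtLang R).Functions n}
    {ts : Fin n → (dtLang R).Term V} {t' : (dtLang R).Term V} (hg : g ∈ DefSyms (D ∪ embR R) n)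
    (hts : ∀ i, ConstructorTerm (D ∪ embR R) (ts i)) (hlow : ∀ i, Low A (ts i))
    (hst : iter (RelIto (relOf R D S)) e (.func g ts) t') :
    e = 0 ∨ ∃ f : L.Functions n, ∃ hf : f ∈ DefSyms R n, g = DTFunctions.sharp f hf ∧
      P (.func f fun i => abstr c (ts i)) e := by
  obtain ⟨f, hf, rfl | rfl⟩ := defSyms_cases h.trs h.dt hg
  · left
    cases e with
    | zero => rfl
    | succ e =>
      obtain ⟨w, hw, -⟩ := hst
      exact absurd hw (low_relIto h hA hθ (s := baseApp R f ts) hlow)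
  · obtain he | ⟨w, ⟨_, f', ss, vs, hw, rfl, hstar⟩, hP⟩ :=
      (potential_of_iter h hA hθ hPS hPW (.sharp f hf ts hlow) hst).sharp_inv
    · exact .inl he
    · cases hw
      have : vs = fun i => abstr c (ts i) := funext fun i => star_eq_of_nf (hstar i)
        (nf_abstr Set.subset_union_right hθ (hlow i) ((hts i).nf (lhs_ne_var h.trs h.dt)))
      exact .inr ⟨f, hf, rfl, this ▸ hP⟩

end Potential

/-! ### Joining chain trees -/

section ChainTrees

variable {L : FirstOrder.Language.{u, u'}} {V : Type v}

/-- The tree with the given label at the root and the given trees as its children. -/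
def LTree.join {L' : FirstOrder.Language.{u, u'}} (a : Rule L' V × (V → L'.Term V)) {m : ℕ}
    (ch : Fin m → Option (LTree L' V)) : LTree L' V where
  label
    | [] => some a
    | i :: p => if h : i < m then (ch ⟨i, h⟩).bind fun T => T.label p else none
  prefix_closed
    | [], _, h => by simp at h
    | j :: p, i, h => by
      simp only [List.cons_append] at h ⊢
      split_ifs at h ⊢ with hj
      · cases hT : ch ⟨j, hj⟩ with
        | none => rfl
        | some T =>
          rw [hT] at h
          exact T.prefix_closed p i h
      · rfl

theorem LTree.le_count_join {L' : FirstOrder.Language.{u, u'}} {S : Set (Rule L' V)}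
    {a : Rule L' V × (V → L'.Term V)} {m : ℕ} {ch : Fin m → Option (LTree L' V)} {δ : ℕ}
    (hδ : δ = 0 ∨ δ = 1 ∧ a.1 ∈ S) {es : Fin m → ℕ}
    (hes : ∀ i, es i = 0 ∨ ∃ T, ch i = some T ∧ (es i : ℕ∞) ≤ T.count S) :
    ((δ + ∑ i, es i : ℕ) : ℕ∞) ≤ (LTree.join a ch).count S := by
  set N : Fin m → Set (List ℕ) := fun i =>
    {p | ∃ ρ μ, (ch i).bind (fun T => T.label p) = some (ρ, μ) ∧ ρ ∈ S} with hNdef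
  have hN : ∀ i, (es i : ℕ∞) ≤ (List.cons i.val '' N i).encard := fun i => by
    rw [(List.cons_injective).encard_image]
    obtain h | ⟨T, hT, h⟩ := hes i
    · simp [h]
    · refine h.trans_eq ?_
      simp [hNdef, hT, LTree.count]
  have hU : ((∑ i, es i : ℕ) : ℕ∞) ≤ (⋃ i, List.cons i.val '' N i).encard := by
    rw [Set.encard_iUnion_of_finite, finsum_eq_sum_of_fintype, Nat.cast_sum]
    · exact Finset.sum_le_sum fun i _ => hN i
    · intro i j hij
      rw [Function.onFun, Set.disjoint_left]
      rintro _ ⟨p, -, rfl⟩ ⟨q, -, hq⟩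
      injection hq with hq
      exact hij (Fin.ext hq.symm)
  have hsub : (⋃ i, List.cons i.val '' N i) ⊆
      {p | ∃ ρ μ, (LTree.join a ch).label p = some (ρ, μ) ∧ ρ ∈ S} := by
    refine Set.iUnion_subset fun i => ?_
    rintro _ ⟨p, ⟨ρ, μ, hp, hρ⟩, rfl⟩
    exact ⟨ρ, μ, by simpa [LTree.join] using hp, hρ⟩
  obtain rfl | ⟨rfl, ha⟩ := hδ
  · rw [zero_add]
    exact hU.trans (Set.encard_le_encard hsub)
  · have hroot : insert [] (⋃ i, List.cons i.val '' N i) ⊆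
        {p | ∃ ρ μ, (LTree.join a ch).label p = some (ρ, μ) ∧ ρ ∈ S} :=
      Set.insert_subset ⟨a.1, a.2, rfl, ha⟩ hsub
    refine le_trans ?_ (Set.encard_le_encard hroot)
    rw [Set.encard_insert_of_notMem (by simp), Nat.cast_add, add_comm]
    exact add_le_add hU le_rfl

variable {R : Set (Rule L V)}

/-- `s♯` has a chain tree with at least `e` nodes that are labelled with elements of `S`. -/
def TreeCount (D S : Set (Rule (dtLang R) V)) (s : L.Term V) (e : ℕ) : Prop :=
  ∃ T, IsChainTree R D (sharp R (emb R s)) T ∧ (e : ℕ∞) ≤ T.count S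

theorem TreeCount.le_cplx {D S : Set (Rule (dtLang R) V)} {s : L.Term V} {e : ℕ}
    (h : TreeCount D S s e) : (e : ℕ∞) ≤ Cplx R D S (sharp R (emb R s)) := by
  obtain ⟨T, hT, he⟩ := h
  exact le_iSup₂_of_le T hT he

theorem nf_sharpApp (hR : IsTRS R) {n : ℕ} {f : L.Functions n} {hf : f ∈ DefSyms R n}
    {ts : Fin n → (dtLang R).Term V} (h : ∀ i, NF (embR R) (ts i)) :
    NF (embR R) (sharpApp f hf ts) := by
  rintro ⟨t, ht⟩
  obtain ⟨ρ, hρ, σ, hl, -⟩ | ⟨i, t', ht', -⟩ := ht.func_inv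
  · obtain ⟨_, _, _, _, hl'⟩ := embR_lhs hR hρ
    rw [hl'] at hl
    injection hl with h1 h2
    subst h1
    cases eq_of_heq h2
  · exact h i ⟨_, ht'⟩

theorem contributes_treeCount [Nonempty V] (hR : IsTRS R) {D S : Set (Rule (dtLang R) V)}
    {ρ : Rule (dtLang R) V} (hρ : ρ ∈ D) (hdt : IsDT R ρ) {δ : ℕ}
    (hδ : δ = 0 ∨ δ = 1 ∧ ρ ∈ S) : Contributes (TreeCount D S) δ ρ := by
  obtain ⟨n, f, hf, ls, m, ws, hl, hr, hws, hv⟩ := hdt.lhs_rhs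
  refine ⟨n, f, hf, ls, m, ws, hl, hr, hws, hv, fun σ es hN hes => ?_⟩
  have hch : ∀ i, ∃ o : Option (LTree (dtLang R) V),
      (es i = 0 ∨ ∃ T, o = some T ∧ (es i : ℕ∞) ≤ T.count S) ∧
      ∀ T, o = some T → ∃ w, ArgsRewrite R ((ws i).subst σ) w ∧
        IsChainTree R D (sharp R (emb R w)) T := fun i => by
    obtain h | ⟨w, hw, T, hT, he⟩ := hes i
    · exact ⟨none, .inl h, by simp⟩
    · refine ⟨some T, .inr ⟨T, rfl, he⟩, ?_⟩
      rintro _ ⟨⟩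
      exact ⟨w, hw, hT⟩
  choose ch hcount hch using hch
  have hlσ : ρ.lhs.subst (fun x => emb R (σ x)) =
      sharpApp f hf fun i => emb R ((ls i).subst σ) := by
    rw [hl]
    exact congrArg (sharpApp f hf) (funext fun i => emb_subst _ _)
  refine ⟨LTree.join (ρ, fun x => emb R (σ x)) ch, ⟨⟨ρ, _, rfl, ?_⟩, ?_, ?_⟩,
    LTree.le_count_join hδ hcount⟩
  · rw [hlσ, sharp_emb_func hf]
  · intro p ρ' μ hp
    cases p with
    | nil =>
      simp only [LTree.join, Option.some.injEq, Prod.mk.injEq] at hp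
      obtain ⟨rfl, rfl⟩ := hp
      refine ⟨hρ, ?_⟩
      rw [hlσ]
      exact nf_sharpApp hR fun i => nf_emb (hN i)
    | cons i p =>
      simp only [LTree.join] at hp
      split_ifs at hp with hi
      obtain ⟨T, hT, hp⟩ := Option.bind_eq_some_iff.1 hp
      obtain ⟨w, -, hw⟩ := hch _ T hT
      exact hw.node p ρ' μ hp
  · intro p i ρ' μ ρ'' μ' hp hpi
    cases p with
    | nil =>
      simp only [LTree.join, Option.some.injEq, Prod.mk.injEq] at hp
      obtain ⟨rfl, rfl⟩ := hp
      simp only [LTree.join, List.nil_append] at hpi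
      split_ifs at hpi with hi
      obtain ⟨T, hT, hp⟩ := Option.bind_eq_some_iff.1 hpi
      obtain ⟨w, hw, hwT⟩ := hch _ T hT
      refine ⟨m, _, hi, hr, ?_⟩
      obtain ⟨ρ₀, μ₀, h₀, h₀'⟩ := hwT.root
      rw [hp] at h₀
      cases h₀
      rw [h₀']
      obtain ⟨k, g, ts, hg, hts⟩ := hws ⟨i, hi⟩
      obtain ⟨_, g', ss, vs, hss, rfl, hstar⟩ := hw
      rw [hts] at hss ⊢
      cases hss
      rw [sharp_emb_func hg, sharp_emb_func hg]
      have : (sharpApp g hg fun j => emb R (ts j)).subst (fun x => emb R (σ x)) =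
          sharpApp g hg fun j => emb R ((ts j).subst σ) :=
        congrArg (sharpApp g hg) (funext fun j => emb_subst _ _)
      rw [this]
      exact IStep.star_args (L := dtLang R) (DTFunctions.sharp g hg) fun j =>
        (hstar j).lift (emb R) fun _ _ h => IStep.emb hR h
    | cons j p =>
      simp only [LTree.join, List.cons_append] at hp hpi
      split_ifs at hp hpi with hj
      obtain ⟨T, hT, hp⟩ := Option.bind_eq_some_iff.1 hp
      obtain ⟨T', hT', hpi⟩ := Option.bind_eq_some_iff.1 hpi
      rw [hT] at hT'
      cases hT'
      obtain ⟨w, -, hw⟩ := hch _ T hT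
      exact hw.edge p i ρ' μ ρ'' μ' hp hpi

end ChainTrees

/-! ### Parallel dependency tuples -/

section PDT

variable {L : FirstOrder.Language.{u, u'}} {V : Type v} {R : Set (Rule L V)}

/-- The parallel dependency tuples contribute to the lengths of parallel-innermost sequences. -/
theorem PDT.isDT_and_contributes (hR : IsTRS R) {ρ : Rule (dtLang R) V} (hρ : ρ ∈ PDT R) :
    IsDT R ρ ∧ (Confluent (Pito R) → Contributes (PitoCall R) 1 ρ) := by
  obtain ⟨ρ, hρ, πs, ⟨⟨hdef, hpair⟩, -⟩, us, hus, rfl⟩ := hρ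
  have hws : ∀ i, ∃ (k : ℕ) (g : L.Functions k) (ts : Fin k → L.Term V),
      g ∈ DefSyms R k ∧ us i = .func g ts := fun i => by
    obtain ⟨k, g, ts, h, hg⟩ := hdef _ (List.get_mem πs i)
    rw [hus i, Option.some.injEq] at h
    exact ⟨k, g, ts, hg, h⟩
  have hv : ∀ i, tvars (us i) ⊆ tvars ρ.lhs := fun i =>
    (tvars_subtermAt (hus i)).trans (hR ρ hρ).2
  cases hl : ρ.lhs with
  | var x => exact absurd hl ((hR ρ hρ).1 x)
  | @func n f ls =>
    have hf : f ∈ DefSyms R n := ⟨ρ, hρ, ls, hl⟩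
    rw [hl] at hv
    refine ⟨⟨⟨n, f, ls, hf, rfl⟩, ⟨_, _, fun i => ?_, rfl⟩, ?_⟩, fun hC => ?_⟩
    · obtain ⟨k, g, ts, hg, h⟩ := hws i
      exact ⟨k, g, ts, hg, by rw [h]⟩
    · rw [VarCond, sharp_emb_func hf]
      simp only [com, tvars, tvars_emb]
      refine Set.iUnion_subset fun i => ?_
      have hvi := hv i
      obtain ⟨k, g, ts, hg, h⟩ := hws i
      rw [h] at hvi
      rw [h, sharp_emb_func hg]
      simp only [tvars, tvars_emb] at hvi ⊢
      exact hvi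
    · refine ⟨n, f, hf, ls, _, us, sharp_emb_func hf ls, rfl, hws, hv, fun σ es hN hes => ?_⟩
      obtain ⟨t', ht'⟩ := iter_pito_depChain hR hC ρ.rhs σ πs us es hpair hus hes
      refine ⟨properSubterms_nf_iff.2 hN, t', ?_⟩
      rw [add_comm]
      exact ⟨_, Pito.root hρ (by rw [hl]; rfl) hN, ht'⟩

end PDT

/-! ### Basic terms -/

section BasicTerms

variable {L : FirstOrder.Language.{u, u'}} {V : Type v} {R : Set (Rule L V)}

/-- The type assignment of the shape that is required by `IsDTTyping`. -/
def dtTyping (R : Set (Rule L V)) : TypeAssignment (dtLang R) TwoSort where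
  dom := fun f _ => match f with
    | DTFunctions.base _ => .bot
    | DTFunctions.sharp _ _ => .bot
    | DTFunctions.com => .dt
  cod := fun f => match f with
    | DTFunctions.base _ => .bot
    | DTFunctions.sharp _ _ => .dt
    | DTFunctions.com => .dt

theorem isDTTyping_dtTyping : IsDTTyping R (dtTyping R) where
  base _ _ := ⟨rfl, fun _ => rfl⟩
  sharp _ _ _ := ⟨rfl, fun _ => rfl⟩
  com _ := ⟨rfl, fun _ => rfl⟩

theorem hasSort_emb (s : L.Term V) : HasSort (dtTyping R) (fun _ => .bot) (emb R s) .bot := by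
  induction s with
  | var x => rfl
  | func f ts ih => exact ⟨rfl, ih⟩

theorem hasSort_sharp {n : ℕ} {f : L.Functions n} (hf : f ∈ DefSyms R n)
    (ts : Fin n → L.Term V) :
    HasSort (dtTyping R) (fun _ => .bot) (sharpApp f hf fun i => emb R (ts i)) .dt :=
  ⟨rfl, fun i => hasSort_emb (ts i)⟩

theorem ruleWellTyped_dtTyping {D : Set (Rule (dtLang R) V)} (hD : ∀ ρ ∈ D, IsDT R ρ) :
    ∀ ρ ∈ D ∪ embR R, RuleWellTyped (dtTyping R) ρ := by
  rintro ρ (hρ | ⟨ρ, -, rfl⟩)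
  · obtain ⟨n, f, hf, ls, m, ws, hl, hr, hws, -⟩ := (hD ρ hρ).lhs_rhs
    refine ⟨fun _ => .bot, .dt, hl ▸ hasSort_sharp hf ls, ?_⟩
    rw [hr]
    refine ⟨rfl, fun i => ?_⟩
    obtain ⟨k, g, ts, hg, h⟩ := hws i
    have hi : sharp R (emb R (ws i)) = sharpApp g hg fun j => emb R (ts j) := by
      rw [h, sharp_emb_func hg]
    have hs := hasSort_sharp hg ts
    rw [← hi] at hs
    exact hs
  · exact ⟨fun _ => .bot, .bot, hasSort_emb _, hasSort_emb _⟩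

theorem low_range_var_of_hasSort {Γ : V → TwoSort} : ∀ {t : (dtLang R).Term V},
    HasSort (dtTyping R) Γ t .bot → Low (Set.range FirstOrder.Language.Term.var) t
  | .var x, _ => ⟨x, rfl⟩
  | .func (DTFunctions.base _) _, h => fun i => low_range_var_of_hasSort (h.2 i)
  | .func (DTFunctions.sharp _ _) _, h => by cases h.1
  | .func DTFunctions.com _, h => by cases h.1

theorem finite_subterms {L' : FirstOrder.Language.{u, u'}} (t : L'.Term V) :
    {s | ∃ π, subtermAt π t = some s}.Finite := by
  induction t with
  | var x =>
    refine (Set.finite_singleton (.var x)).subset ?_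
    rintro s ⟨π, h⟩
    cases π with
    | nil => simpa [subtermAt, eq_comm] using h
    | cons => simp [subtermAt] at h
  | func f ts ih =>
    refine ((Set.finite_iUnion ih).insert (.func f ts)).subset ?_
    rintro s ⟨π, h⟩
    cases π with
    | nil => exact .inl (by simpa [subtermAt, eq_comm] using h)
    | cons i π =>
      simp only [subtermAt] at h
      split_ifs at h with hi
      exact .inr (Set.mem_iUnion.2 ⟨_, π, h⟩)

theorem low_of_subterms {A : Set ((dtLang R).Term V)} :
    ∀ {t : (dtLang R).Term V}, (∀ π s, subtermAt π t = some s → s ∈ A) → Low A t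
  | .var _, h => h [] _ rfl
  | .func (DTFunctions.base f) ts, h => fun i => low_of_subterms fun π s hs =>
      h (i.val :: π) s (by simpa [subtermAt] using hs)
  | .func (DTFunctions.sharp _ _) _, h => h [] _ rfl
  | .func DTFunctions.com _, h => h [] _ rfl

theorem ConstructorTerm.subtermAt {L' : FirstOrder.Language.{u, u'}} {Q : Set (Rule L' V)} :
    ∀ {π : List ℕ} {t s : L'.Term V}, ConstructorTerm Q t → subtermAt π t = some s →
      ConstructorTerm Q s
  | [], t, s, ht, h => by
    simp only [DepTuple.subtermAt, Option.some.injEq] at h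
    exact h ▸ ht
  | _ :: _, .var _, _, _, h => by simp [DepTuple.subtermAt] at h
  | i :: π, .func f ts, s, ht, h => by
    simp only [DepTuple.subtermAt] at h
    split_ifs at h with hi
    exact ConstructorTerm.subtermAt (ht.2 _) h

theorem constructorTerm_abstr {Q : Set (Rule (dtLang R) V)} (hQ : embR R ⊆ Q)
    (c : (dtLang R).Term V → V) :
    ∀ {t : (dtLang R).Term V}, ConstructorTerm Q t → ConstructorTerm R (abstr c t)
  | .var _, _ => trivial
  | .func (DTFunctions.base f) ts, h => by
    refine ⟨?_, fun i => constructorTerm_abstr hQ c (h.2 i)⟩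
    rintro ⟨ρ, hρ, ls, hl⟩
    exact h.1 ⟨_, hQ ⟨ρ, hρ, rfl⟩, fun i => emb R (ls i), congrArg (emb R) hl⟩
  | .func (DTFunctions.sharp _ _) _, _ => trivial
  | .func DTFunctions.com _, _ => trivial

theorem tsize_abstr_le (c : (dtLang R).Term V → V) :
    ∀ t : (dtLang R).Term V, tsize (abstr c t) ≤ tsize t
  | .var _ => le_rfl
  | .func (DTFunctions.base _) ts =>
    Nat.add_le_add_left (Finset.sum_le_sum fun i _ => tsize_abstr_le c (ts i)) 1
  | .func (DTFunctions.sharp _ _) _ => Nat.le_add_right 1 _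
  | .func DTFunctions.com _ => Nat.le_add_right 1 _

variable {D S : Set (Rule (dtLang R) V)} {P : L.Term V → ℕ → Prop}

/-- The bound for basic terms that need not be well typed: their maximal subterms with sharp or
compound roots are replaced by variables, equal ones by equal and different ones by different
variables.  This is possible as there are infinitely many variables. -/
theorem ircRel_le [Infinite V] (h : IsDTProblem R D S) (hPS : ∀ ρ ∈ S, Contributes P 1 ρ)
    (hPW : ∀ ρ ∈ D \ S, Contributes P 0 ρ) {n : ℕ} {x : ℕ∞}
    (hx : ∀ t ∈ Basic R, tsize t ≤ n → ∀ e, P t e → (e : ℕ∞) ≤ x) :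
    ircRel (relOf R D S) n ≤ x := by
  refine iSup₂_le fun t ⟨ht, hn⟩ => Dh_le fun e t' hst => ?_
  rw [relOf_strict_union_weak h.sub] at ht
  obtain ⟨k, g, ts, rfl, hg, hts⟩ := ht
  set A : Set ((dtLang R).Term V) := ⋃ i, {s | ∃ π, subtermAt π (ts i) = some s} with hAdef
  have hfin : A.Finite := Set.finite_iUnion fun i => finite_subterms (ts i)
  obtain ⟨c, -, hc⟩ := hfin.exists_injOn_of_encard_le (t := (Set.univ : Set V))
    (by rw [Set.infinite_univ.encard_eq]; exact le_top)
  have hA : ∀ a ∈ A, ConstructorTerm (D ∪ embR R) a := fun a ha => by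
    obtain ⟨i, π, hπ⟩ := Set.mem_iUnion.1 ha
    exact (hts i).subtermAt hπ
  have hlow : ∀ i, Low A (ts i) := fun i => low_of_subterms fun π s hs =>
    Set.mem_iUnion.2 ⟨i, π, hs⟩
  have : Nonempty ((dtLang R).Term V) := ⟨.func g ts⟩
  obtain rfl | ⟨f, hf, rfl, hP⟩ :=
    bound_of_iter h hA (fun a ha => hc.leftInvOn_invFunOn ha) hPS hPW hg hts hlow hst
  · simp
  · refine hx _ ⟨k, f, _, rfl, hf, fun i =>
      constructorTerm_abstr Set.subset_union_right c (hts i)⟩ (le_trans ?_ hn) e hP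
    exact Nat.add_le_add_left (Finset.sum_le_sum fun i _ => tsize_abstr_le c (ts i)) 1

theorem Dh_le_cplx_of_wellTyped [Nonempty V] (h : IsDTProblem R D S) {t : (dtLang R).Term V}
    (ht : t ∈ Basic (D ∪ embR R)) (hty : WellTyped (dtTyping R) t) :
    Dh (RelIto (relOf R D S)) t ≤ Cplx R D S (sharp R t) := by
  refine Dh_le fun e t' hst => ?_
  obtain ⟨k, g, ts, rfl, hg, hts⟩ := ht
  obtain ⟨Γ, τ, -, hΓ⟩ := hty
  have hlow : ∀ i, Low (Set.range FirstOrder.Language.Term.var) (ts i) := fun i => by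
    obtain ⟨f, hf, rfl | rfl⟩ := defSyms_cases h.trs h.dt hg
    · exact low_range_var_of_hasSort (hΓ i)
    · exact low_range_var_of_hasSort (hΓ i)
  have hθ : ∀ a ∈ Set.range (FirstOrder.Language.Term.var (L := dtLang R) (α := V)),
      FirstOrder.Language.Term.var (L := dtLang R) (varName a) = a := by
    rintro _ ⟨x, rfl⟩
    rw [varName_var]
  obtain rfl | ⟨f, hf, rfl, hP⟩ := bound_of_iter h (by rintro _ ⟨x, rfl⟩; trivial) hθ
    (fun ρ hρ => contributes_treeCount h.trs (S := S) (h.sub hρ) (h.dt ρ (h.sub hρ))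
      (.inr ⟨rfl, hρ⟩))
    (fun ρ hρ => contributes_treeCount h.trs (S := S) hρ.1 (h.dt ρ hρ.1) (.inl rfl)) hg hts hlow hst
  · simp
  · have := hP.le_cplx
    rw [sharp_emb_func hf] at this
    have hemb : (fun i => emb R (abstr varName (ts i))) = ts := funext fun i => by
      conv_rhs => rw [← emb_abstr_subst hθ (hlow i), subst_var]
    rw [hemb] at this
    exact this

end BasicTerms

end DepTuple

theorem theorem4p4 {L : FirstOrder.Language.{u, u'}} {V : Type v} [Infinite V]
    (R : Set (Rule L V)) :
    (∀ D S : Set (Rule (dtLang R) V), IsDTProblem R D S →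
      (∃ Θ : TypeAssignment (dtLang R) TwoSort, IsDTTyping R Θ ∧
        (∀ ρ ∈ D ∪ embR R, RuleWellTyped Θ ρ) ∧
        ∀ t ∈ Basic (D ∪ embR R), WellTyped Θ t →
          Dh (RelIto (relOf R D S)) t ≤ Cplx R D S (sharp R t)) ∧
      ∀ n : ℕ, ircRel (relOf R D S) n ≤ ircDT R D S n) ∧
    (IsTRS R → Confluent (Pito R) →
      ∀ n : ℕ, ircRel (relOf R (PDT R) (PDT R)) n ≤ pirc R n) := by
  refine ⟨fun D S h => ⟨⟨dtTyping R, isDTTyping_dtTyping, ruleWellTyped_dtTyping h.dt,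
    fun t ht hty => Dh_le_cplx_of_wellTyped h ht hty⟩, fun n => ?_⟩, fun hR hC n => ?_⟩
  · refine ircRel_le (P := TreeCount D S) h
      (fun ρ hρ => contributes_treeCount h.trs (h.sub hρ) (h.dt ρ (h.sub hρ)) (.inr ⟨rfl, hρ⟩))
      (fun ρ hρ => contributes_treeCount h.trs hρ.1 (h.dt ρ hρ.1) (.inl rfl))
      fun t ht hn e he => ?_
    exact le_iSup₂_of_le t ⟨ht, hn⟩ he.le_cplx
  · refine ircRel_le (P := PitoCall R)
      ⟨hR, fun ρ hρ => (PDT.isDT_and_contributes hR hρ).1, subset_rfl⟩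
      (fun ρ hρ => (PDT.isDT_and_contributes hR hρ).2 hC) (fun ρ hρ => absurd hρ.1 hρ.2)
      fun t ht hn e ⟨_, t', ht'⟩ => ?_
    exact le_iSup₂_of_le t ⟨ht, hn⟩ (le_Dh ht')
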